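/- All graphs are finite and simple. A clique in a graph is *strong* if it intersects every (inclusion-)maximal independent set of the graph, and a graph is *localizable* if its vertex set can be partitioned into strong cliques. A graph is *vertex-transitive* if for any two vertices $u,v$ some automorphism maps $u$ to $v$, and it is *4-valent* if every vertex has exactly four neighbours. For $n\ge 2$ let $H_n$ be the graph of order $4n$ with vertex set $\{x_i,y_i,z_i,w_i : 1\le i\le n\}$ in which, for every $i$, the vertices $x_i,y_i,z_i,w_i$ are pairwise adjacent, $z_i\sim x_{i+1}$ and $w_i\sim y_{i+1}$ (index $i$ taken modulo $n$), and there are no other edges. Write $\Gamma_1[\Gamma_2]$ for the lexicographic product (vertex set $V(\Gamma_1)\times V(\Gamma_2)$, with $(u,x)\sim(v,y)$ iff $u\sim v$ in $\Gamma_1$, or $u=v$ and $x\sim y$ in $\Gamma_2$), $2K_1$ for the edgeless graph on two vertices, $\Gamma_1\square\Gamma_2$ for the Cartesian product, $L(\Gamma)$ for the line graph, $C_n$ for the cycle of length $n$, and $\mathrm{Cay}(A,S)$ for the Cayley graph of the additive group $A$ with connection set $S$ (with $a\sim b$ iff $b-a\in S$). **Theorem 5.3.** Let $\Gamma$ be a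 connected 4-valent vertex-transitive graph. Then $\Gamma$ admits a strong clique if and only if $\Gamma$ is isomorphic to one of the graphs $K_{4,4}$, $K_5$, $K_3[2K_1]$, $L(K_{3,3})$, $H_n$ for some $n\ge 2$, $\mathrm{Cay}(\mathbb{Z}_{3k},\{\pm1,\pm k\})$ for some $k\ge 2$, or $C_3\square C_n$ for some $n\ge 3$. In particular, every 4-valent vertex-transitive graph (connected or not) that admits a strong clique is localizable. -/

import Mathlib

namespace SimpleGraph

/-- A strong clique: a clique that meets every (inclusion-)maximal independent set. -/
def IsStrongClique {V : Type*} (G : SimpleGraph V) (C : Set V) : Prop :=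
  G.IsClique C ∧ ∀ I : Set V, Maximal G.IsIndepSet I → (C ∩ I).Nonempty

/-- A graph is localizable if its vertex set can be partitioned into strong cliques. -/
def IsLocalizable {V : Type*} (G : SimpleGraph V) : Prop :=
  ∃ P : Set (Set V), Setoid.IsPartition P ∧ ∀ C ∈ P, G.IsStrongClique C

/-- A graph is vertex-transitive if its automorphism group acts transitively on the vertices. -/
def IsVertexTransitive {V : Type*} (G : SimpleGraph V) : Prop :=
  ∀ u v : V, ∃ φ : G ≃g G, φ u = v

/-- The lexicographic product `G[H]`. -/
def lexProduct {V W : Type*} (G : SimpleGraph V) (H : SimpleGraph W) : SimpleGraph (V × W) where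
  Adj p q := G.Adj p.1 q.1 ∨ (p.1 = q.1 ∧ H.Adj p.2 q.2)
  symm := ⟨fun _ _ h => h.imp (fun h => h.symm) (fun h => ⟨h.1.symm, h.2.symm⟩)⟩
  loopless := ⟨fun _ h => h.elim G.irrefl (fun h => H.irrefl h.2)⟩

/-- The graph `H_n` of order `4 n` (intended for `n ≥ 2`).  The vertices `x_i, y_i, z_i, w_i` are
`(i, 0), (i, 1), (i, 2), (i, 3)`, with the index `i` read modulo `n`.  For each `i` the four
vertices `x_i, y_i, z_i, w_i` are pairwise adjacent, and `z_i ∼ x_{i+1}`, `w_i ∼ y_{i+1}`. -/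
def graphH (n : ℕ) : SimpleGraph (ZMod n × Fin 4) :=
  SimpleGraph.fromRel fun p q =>
    p.1 = q.1 ∨
      (q.1 = p.1 + 1 ∧ ((p.2 = 2 ∧ q.2 = 0) ∨ (p.2 = 3 ∧ q.2 = 1)))

end SimpleGraph

/-!
A clique is strong exactly when no independent set dominates it.  This turns strength into a local
condition: whenever a neighbour is chosen for each vertex of the clique, two of the chosen
vertices are adjacent.  The images of a strong clique under automorphisms are strong, so in a
vertex-transitive graph every vertex has the same local structure.  All isomorphisms are obtained
from `IsFourValent.nonempty_iso`: an injective homomorphism from a graph of minimum degree at least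
four to a connected 4-valent graph is bijective and reflects adjacency.

Let `C` be a strong clique of a connected 4-valent vertex-transitive graph.
* A single vertex is never strong.  A strong edge gives `K_{4,4}`, and five pairwise adjacent
  vertices give `K_5`.
* If `C` has four vertices and the graph is not `K_5`, the twin classes are trivial, because their
  size divides the order five of a closed neighbourhood (`IsFourValent.not_isTwin`).  Hence the
  edges form a partition into 4-cliques together with a perfect matching.  Strength says that two
  matching edges leaving the same clique end in the same clique; following these pairs of
  parallel edges, or observing that they come in fours, gives some `H_n`
  (`IsFourValent.nonempty_iso_graphH`).
* If `C` has three vertices and some edge is in two triangles, the neighbourhoods are 4-cycles and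
  the graph is the octahedron `K_3[2K_1]` (`IsStrongClique.eq_of_common`).  Otherwise every edge is
  in at most one triangle.  If every edge is in one, the graph is `L(K_{3,3})`, which is
  `C_3 □ C_3` (`IsStrongClique.nonempty_iso_rook`).  If some edge is in none, every vertex is in a
  unique triangle, and this triangle is strong.  Two triangles joined by an edge turn out to be
  joined by a perfect matching (`IsTriangleSystem.isLinked_of_rel`), since single and double links
  contradict strength or transitivity.  So the triangles form a cycle of length `n`, traversed by
  three parallel walks.  These return to the initial triangle after a permutation: the identity
  gives `C_3 □ C_n`, a 3-cycle gives the Cayley graph of `ℤ_{3n}`, and a transposition is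
  impossible, because it would make the three vertices of a triangle inequivalent.

Conversely, all graphs of the list are localizable, by classes of vertices with the same label.
The components of a vertex-transitive graph are isomorphic to each other, so the last assertion
follows from the connected case.
-/

namespace SimpleGraph

variable {V W : Type*} {G : SimpleGraph V}

/-! ### Strong cliques -/

/-- In a finite graph a clique is strong exactly when no independent set dominates it. -/
theorem isStrongClique_iff [Finite V] {C : Set V} :
    G.IsStrongClique C ↔
      G.IsClique C ∧ ∀ D : Set V, G.IsIndepSet D → ∃ c ∈ C, ∀ d ∈ D, ¬ G.Adj c d := by
  refine and_congr_right fun _ => ⟨fun h D hD => ?_, fun h I hI => ?_⟩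
  · obtain ⟨I, hDI, hI⟩ := Finite.exists_le_maximal hD
    obtain ⟨c, hc, hcI⟩ := h I hI
    exact ⟨c, hc, fun d hd had => hI.1 hcI (hDI hd) had.ne had⟩
  · obtain ⟨c, hc, hcI⟩ := h I hI.1
    refine ⟨c, hc, ?_⟩
    have : G.IsIndepSet (insert c I) := by
      intro x hx y hy hxy hadj
      rcases hx with rfl | hx <;> rcases hy with rfl | hy
      · exact hxy rfl
      · exact hcI _ hy hadj
      · exact hcI _ hx hadj.symm
      · exact hI.1 hx hy hxy hadj
    exact hI.2 this (Set.subset_insert c I) (Set.mem_insert c I)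

theorem IsStrongClique.image [Finite V] [Finite W] {H : SimpleGraph W}
    {C : Set V} (h : G.IsStrongClique C) (φ : G ≃g H) : H.IsStrongClique (φ '' C) := by
  rw [isStrongClique_iff] at h ⊢
  refine ⟨?_, fun D hD => ?_⟩
  · rintro _ ⟨x, hx, rfl⟩ _ ⟨y, hy, rfl⟩ hxy
    exact φ.map_adj_iff.2 (h.1 hx hy fun e => hxy (e ▸ rfl))
  · obtain ⟨c, hc, hcD⟩ := h.2 (φ ⁻¹' D) fun x hx y hy hxy hadj =>
      hD hx hy (fun e => hxy (φ.injective e)) (φ.map_adj_iff.2 hadj)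
    refine ⟨φ c, ⟨c, hc, rfl⟩, fun d hd hadj => ?_⟩
    refine hcD (φ.symm d) (by simpa using hd) ?_
    rw [← φ.map_adj_iff]; simpa using hadj

theorem IsStrongClique.nonempty [Finite V] {C : Set V}
    (h : G.IsStrongClique C) : C.Nonempty := by
  obtain ⟨c, hc, -⟩ := (isStrongClique_iff.1 h).2 ∅ (by simp [IsIndepSet])
  exact ⟨c, hc⟩

/-- A localization can be given by the map sending a vertex to the strong clique containing it. -/
theorem isLocalizable_iff :
    G.IsLocalizable ↔ ∃ f : V → Set V, ∀ v, v ∈ f v ∧ G.IsStrongClique (f v) ∧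
      ∀ u ∈ f v, f u = f v := by
  constructor
  · rintro ⟨P, hP, hs⟩
    choose f hf hu using hP.2
    refine ⟨f, fun v => ⟨(hf v).2, hs _ (hf v).1, fun u huv => ?_⟩⟩
    exact (hu u (f v) ⟨(hf v).1, huv⟩).symm
  · rintro ⟨f, hf⟩
    refine ⟨Set.range f, ⟨?_, fun a => ⟨f a, ⟨⟨a, rfl⟩, (hf a).1⟩, ?_⟩⟩, ?_⟩
    · rintro ⟨v, hv⟩
      have := (hf v).1
      simp [hv] at this
    · rintro _ ⟨⟨b, rfl⟩, hb⟩
      exact ((hf b).2.2 a hb).symm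
    · rintro _ ⟨v, rfl⟩
      exact (hf v).2.1

theorem IsLocalizable.of_iso [Finite V] [Finite W] {H : SimpleGraph W}
    (h : H.IsLocalizable) (φ : G ≃g H) : G.IsLocalizable := by
  rw [isLocalizable_iff] at h ⊢
  obtain ⟨f, hf⟩ := h
  refine ⟨fun v => φ.symm '' f (φ v), fun v => ⟨⟨φ v, (hf _).1, by simp⟩,
    (hf _).2.1.image φ.symm, ?_⟩⟩
  rintro _ ⟨u, hu, rfl⟩
  have := (hf _).2.2 u hu
  simp [this]

theorem IsLocalizable.exists_isStrongClique [Nonempty V]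
    (h : G.IsLocalizable) : ∃ C, G.IsStrongClique C := by
  obtain ⟨f, hf⟩ := isLocalizable_iff.1 h
  exact ⟨_, (hf (Classical.arbitrary V)).2.1⟩

/-- The fibres of a labelling form a localization if they are strong cliques. -/
theorem isLocalizable_of_label {ι : Type*} (g : V → ι)
    (h : ∀ v, G.IsStrongClique {u | g u = g v}) : G.IsLocalizable :=
  isLocalizable_iff.2 ⟨fun v => {u | g u = g v}, fun v => ⟨rfl, h v, fun u hu => by
    have : g u = g v := hu; simp [this]⟩⟩

/-- No independent set dominates a strong triangle: whenever `p`, `q`, `r` are neighbours of its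
three vertices, two of `p`, `q`, `r` are adjacent. -/
theorem IsStrongClique.triangle [Finite V] {a b c : V}
    (h : G.IsStrongClique {a, b, c}) {p q r : V} (hp : G.Adj a p) (hq : G.Adj b q)
    (hr : G.Adj c r) : G.Adj p q ∨ G.Adj q r ∨ G.Adj p r := by
  by_contra! hn
  obtain ⟨x, hx, hD⟩ := (isStrongClique_iff.1 h).2 {p, q, r} (by
    intro x hx y hy hxy hadj
    have := hadj.symm
    simp only [Set.mem_insert_iff, Set.mem_singleton_iff] at hx hy
    rcases hx with rfl | rfl | rfl <;> rcases hy with rfl | rfl | rfl <;> simp_all)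
  simp only [Set.mem_insert_iff, Set.mem_singleton_iff] at hx hD
  rcases hx with rfl | rfl | rfl
  · exact hD p (by simp) hp
  · exact hD q (by simp) hq
  · exact hD r (by simp) hr

theorem isStrongClique_of_triangle [Finite V] {C : Set V} {a b c : V}
    (hC : G.IsClique C) (ha : a ∈ C) (hb : b ∈ C) (hc : c ∈ C)
    (h : ∀ p q r, G.Adj a p → G.Adj b q → G.Adj c r → G.Adj p q ∨ G.Adj q r ∨ G.Adj p r) :
    G.IsStrongClique C := by
  refine isStrongClique_iff.2 ⟨hC, fun D hD => ?_⟩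
  by_contra! hn
  obtain ⟨p, hp, hap⟩ := hn a ha
  obtain ⟨q, hq, hbq⟩ := hn b hb
  obtain ⟨r, hr, hcr⟩ := hn c hc
  have key : ∀ x ∈ D, ∀ y ∈ D, ¬ G.Adj x y := fun x hx y hy hxy => hD hx hy hxy.ne hxy
  rcases h p q r hap hbq hcr with h | h | h
  exacts [key _ hp _ hq h, key _ hq _ hr h, key _ hp _ hr h]

/-- A clique of at least three vertices is strong if the vertices outside it have at most one
neighbour in it and all neighbours outside it lie in the union of two cliques. -/
theorem isStrongClique_of_two_cliques [Finite V] {C P Q : Set V} {a b c : V}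
    (hC : G.IsClique C) (hP : G.IsClique P) (hQ : G.IsClique Q)
    (ha : a ∈ C) (hb : b ∈ C) (hc : c ∈ C) (hab : a ≠ b) (hac : a ≠ c) (hbc : b ≠ c)
    (h1 : ∀ u, u ∉ C → ∀ v ∈ C, ∀ w ∈ C, G.Adj u v → G.Adj u w → v = w)
    (h2 : ∀ v ∈ C, ∀ u, G.Adj v u → u ∈ C ∨ u ∈ P ∨ u ∈ Q) :
    G.IsStrongClique C := by
  refine isStrongClique_iff.2 ⟨hC, fun D hD => ?_⟩
  by_contra! hn
  have hDC : ∀ d ∈ D, d ∉ C := by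
    intro d hd hdC
    obtain ⟨e, he, hde⟩ := hn d hdC
    exact hD hd he hde.ne hde
  have key : ∀ R : Set V, G.IsClique R → ∀ x ∈ D, ∀ y ∈ D, x ∈ R → y ∈ R → x = y := by
    intro R hR x hx y hy hxR hyR
    by_contra hxy
    exact hD hx hy hxy (hR hxR hyR hxy)
  obtain ⟨p, hp, hap⟩ := hn a ha
  obtain ⟨q, hq, hbq⟩ := hn b hb
  obtain ⟨r, hr, hcr⟩ := hn c hc
  have e1 : p ≠ q := fun e => hab (h1 p (hDC p hp) a ha b hb hap.symm (e ▸ hbq.symm))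
  have e2 : p ≠ r := fun e => hac (h1 p (hDC p hp) a ha c hc hap.symm (e ▸ hcr.symm))
  have e3 : q ≠ r := fun e => hbc (h1 q (hDC q hq) b hb c hc hbq.symm (e ▸ hcr.symm))
  have p1 := (h2 a ha p hap).resolve_left (hDC p hp)
  have q1 := (h2 b hb q hbq).resolve_left (hDC q hq)
  have r1 := (h2 c hc r hcr).resolve_left (hDC r hr)
  have k1 := key P hP
  have k2 := key Q hQ
  grind

/-! ### Neighbourhoods in 4-valent graphs -/

theorem IsRegularOfDegree.exists_neighbors [Fintype V] [DecidableRel G.Adj]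
    (h : G.IsRegularOfDegree 4) (v : V) :
    ∃ p q r s, p ≠ q ∧ p ≠ r ∧ p ≠ s ∧ q ≠ r ∧ q ≠ s ∧ r ≠ s ∧
      ∀ x, G.Adj v x ↔ x = p ∨ x = q ∨ x = r ∨ x = s := by
  classical
  have hv : (G.neighborFinset v).card = 3 + 1 := h v
  obtain ⟨p, t, hp, ht, hc⟩ := Finset.card_eq_succ.1 hv
  obtain ⟨q, r, s, h1, h2, h3, rfl⟩ := Finset.card_eq_three.1 hc
  refine ⟨p, q, r, s, ?_⟩
  simp only [Finset.mem_insert, Finset.mem_singleton, not_or] at hp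
  refine ⟨hp.1, hp.2.1, hp.2.2, h1, h2, h3, fun x => ?_⟩
  rw [← mem_neighborFinset, ← ht]
  simp

/-- A graph in which every vertex has exactly four neighbours, stated with the neighbours listed. -/
def IsFourValent (G : SimpleGraph V) : Prop :=
  ∀ v, ∃ p q r s, p ≠ q ∧ p ≠ r ∧ p ≠ s ∧ q ≠ r ∧ q ≠ s ∧ r ≠ s ∧
    ∀ x, G.Adj v x ↔ x = p ∨ x = q ∨ x = r ∨ x = s

theorem IsFourValent.four (h : G.IsFourValent) {v p q r s x : V} (hp : G.Adj v p)
    (hq : G.Adj v q) (hr : G.Adj v r) (hs : G.Adj v s) (h1 : p ≠ q) (h2 : p ≠ r) (h3 : p ≠ s)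
    (h4 : q ≠ r) (h5 : q ≠ s) (h6 : r ≠ s) (hx : G.Adj v x) : x = p ∨ x = q ∨ x = r ∨ x = s := by
  obtain ⟨p', q', r', s', h⟩ := h v
  grind

theorem IsFourValent.three (h : G.IsFourValent) {v p q r : V} (hp : G.Adj v p)
    (hq : G.Adj v q) (hr : G.Adj v r) (h1 : p ≠ q) (h2 : p ≠ r) (h4 : q ≠ r) :
    ∃ s, p ≠ s ∧ q ≠ s ∧ r ≠ s ∧ ∀ x, G.Adj v x ↔ x = p ∨ x = q ∨ x = r ∨ x = s := by
  obtain ⟨p', q', r', s', h⟩ := h v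
  have : ∃ s, p ≠ s ∧ q ≠ s ∧ r ≠ s ∧ G.Adj v s := by
    by_contra! hn
    have h1 := hn p'; have h2 := hn q'; have h3 := hn r'; have h4 := hn s'
    grind
  obtain ⟨s, h3, h5, h6, hs⟩ := this
  exact ⟨s, h3, h5, h6, fun x => by grind⟩

theorem IsFourValent.two (h : G.IsFourValent) {v p q : V} (hp : G.Adj v p)
    (hq : G.Adj v q) (h1 : p ≠ q) :
    ∃ r s, p ≠ r ∧ q ≠ r ∧ p ≠ s ∧ q ≠ s ∧ r ≠ s ∧
      ∀ x, G.Adj v x ↔ x = p ∨ x = q ∨ x = r ∨ x = s := by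
  have : ∃ r, p ≠ r ∧ q ≠ r ∧ G.Adj v r := by
    obtain ⟨p', q', r', s', h⟩ := h v
    by_contra! hn
    have h1 := hn p'; have h2 := hn q'; have h3 := hn r'; have h4 := hn s'
    grind
  obtain ⟨r, h2, h3, hr⟩ := this
  obtain ⟨s, h4⟩ := h.three hp hq hr h1 h2 h3
  exact ⟨r, s, by grind⟩

theorem IsFourValent.one (h : G.IsFourValent) {v p : V} (hp : G.Adj v p) :
    ∃ q r s, p ≠ q ∧ p ≠ r ∧ p ≠ s ∧ q ≠ r ∧ q ≠ s ∧ r ≠ s ∧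
      ∀ x, G.Adj v x ↔ x = p ∨ x = q ∨ x = r ∨ x = s := by
  have : ∃ q, p ≠ q ∧ G.Adj v q := by
    obtain ⟨p', q', r', s', h⟩ := h v
    by_contra! hn
    have h1 := hn p'; have h2 := hn q'
    grind
  obtain ⟨q, h2, hq⟩ := this
  obtain ⟨r, s, h4⟩ := h.two hp hq h2
  exact ⟨q, r, s, by grind⟩

/-- An injective homomorphism from a graph with minimum degree at least four to a connected
4-valent graph is an isomorphism: its image is closed under taking neighbours. -/
theorem IsFourValent.nonempty_iso (h : G.IsFourValent) (hc : G.Connected) [Nonempty W]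
    {H : SimpleGraph W} (f : W → V) (hf : Function.Injective f)
    (hom : ∀ x y, H.Adj x y → G.Adj (f x) (f y))
    (hH : ∀ x, ∃ p q r s, p ≠ q ∧ p ≠ r ∧ p ≠ s ∧ q ≠ r ∧ q ≠ s ∧ r ≠ s ∧
      H.Adj x p ∧ H.Adj x q ∧ H.Adj x r ∧ H.Adj x s) : Nonempty (G ≃g H) := by
  have key : ∀ x v, G.Adj (f x) v → ∃ y, f y = v ∧ H.Adj x y := by
    intro x v hv
    obtain ⟨p, q, r, s, h1, h2, h3, h4, h5, h6, hp, hq, hr, hs⟩ := hH x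
    rcases h.four (hom _ _ hp) (hom _ _ hq) (hom _ _ hr) (hom _ _ hs) (hf.ne h1) (hf.ne h2)
      (hf.ne h3) (hf.ne h4) (hf.ne h5) (hf.ne h6) hv with rfl | rfl | rfl | rfl
    exacts [⟨_, rfl, hp⟩, ⟨_, rfl, hq⟩, ⟨_, rfl, hr⟩, ⟨_, rfl, hs⟩]
  have surj : Function.Surjective f := by
    intro v
    obtain ⟨w⟩ := hc.preconnected (f (Classical.arbitrary W)) v
    have : ∀ {a b : V}, G.Walk a b → a ∈ Set.range f → b ∈ Set.range f := by
      intro a b w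
      induction w with
      | nil => exact id
      | cons hadj _ ih =>
        rintro ⟨x, rfl⟩
        obtain ⟨y, rfl, -⟩ := key x _ hadj
        exact ih ⟨y, rfl⟩
    exact this w ⟨_, rfl⟩
  let e : H ≃g G := ⟨Equiv.ofBijective f ⟨hf, surj⟩, by
    intro x y
    refine ⟨fun hxy => ?_, hom x y⟩
    obtain ⟨z, hz, hxz⟩ := key x (f y) hxy
    exact hf hz ▸ hxz⟩
  exact ⟨e.symm⟩

/-! ### The graphs of the list are localizable -/

theorem isLocalizable_completeBipartiteGraph :
    (completeBipartiteGraph (Fin 4) (Fin 4)).IsLocalizable := by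
  refine isLocalizable_of_label (Sum.elim id id) fun v => isStrongClique_iff.2 ⟨?_, fun D hD => ?_⟩
  · rintro (a | a) ha (b | b) hb hab <;> simp_all
  · set i : Fin 4 := Sum.elim id id v
    by_contra! hn
    obtain ⟨d, hd, hid⟩ := hn (Sum.inl i) rfl
    obtain ⟨e, he, hie⟩ := hn (Sum.inr i) rfl
    rcases d with d | d <;> rcases e with e | e <;> simp at hid hie
    exact hD hd he (by simp) (by simp)

theorem isLocalizable_completeGraph : (completeGraph (Fin 5)).IsLocalizable := by
  refine isLocalizable_of_label (fun _ => ()) fun v => isStrongClique_iff.2 ⟨?_, fun D hD => ?_⟩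
  · intro a _ b _ hab
    exact hab
  · by_contra! hn
    obtain ⟨d, hd, -⟩ := hn v rfl
    obtain ⟨e, he, hde⟩ := hn d rfl
    exact hD hd he hde.ne hde

theorem isLocalizable_lexProduct :
    ((completeGraph (Fin 3)).lexProduct (⊥ : SimpleGraph (Fin 2))).IsLocalizable := by
  refine isLocalizable_of_label Prod.snd fun v => ?_
  refine isStrongClique_of_triangle (a := (0, v.2)) (b := (1, v.2)) (c := (2, v.2))
    ?_ rfl rfl rfl ?_
  · rintro ⟨a, x⟩ ha ⟨b, y⟩ hb hab
    have ha : x = v.2 := ha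
    have hb : y = v.2 := hb
    subst ha
    subst hb
    left
    simpa using hab
  · simp only [lexProduct, completeGraph, top_adj, bot_adj, and_false, or_false]
    rintro ⟨p, _⟩ ⟨q, _⟩ ⟨r, _⟩ hp hq hr
    dsimp only at hp hq hr ⊢
    revert p q r
    decide

theorem isLocalizable_lineGraph :
    (completeBipartiteGraph (Fin 3) (Fin 3)).lineGraph.IsLocalizable := by
  have hm : ∀ i j : Fin 3, s(Sum.inl i, Sum.inr j) ∈
    (completeBipartiteGraph (Fin 3) (Fin 3)).edgeSet := by simp
  let f : Fin 3 × Fin 3 → (completeBipartiteGraph (Fin 3) (Fin 3)).edgeSet :=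
    fun p => ⟨s(Sum.inl p.1, Sum.inr p.2), hm _ _⟩
  have hf : Function.Bijective f := by
    constructor
    · rintro ⟨a, b⟩ ⟨c, d⟩ h
      simpa [f] using h
    · rintro ⟨e, he⟩
      induction e using Sym2.ind with
      | _ x y =>
        rcases x with x | x <;> rcases y with y | y <;> simp at he
        · exact ⟨(x, y), rfl⟩
        · exact ⟨(y, x), Subtype.ext Sym2.eq_swap⟩
  have hadj : ∀ p q, (completeBipartiteGraph (Fin 3) (Fin 3)).lineGraph.Adj (f p) (f q) ↔
      p ≠ q ∧ (p.1 = q.1 ∨ p.2 = q.2) := by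
    rintro ⟨a, b⟩ ⟨c, d⟩
    rw [lineGraph_adj_iff_exists, hf.1.ne_iff]
    simp [f]
  let e := Equiv.ofBijective f hf
  refine isLocalizable_of_label (fun x => (e.symm x).1) fun v => ?_
  obtain ⟨p, rfl⟩ := hf.2 v
  have hs : ∀ q, e.symm (f q) = q := e.symm_apply_apply
  have hcl : ∀ i, (completeBipartiteGraph (Fin 3) (Fin 3)).lineGraph.IsClique
      {u | (e.symm u).1 = i} := by
    intro i x hx y hy hxy
    obtain ⟨a, rfl⟩ := hf.2 x
    obtain ⟨b, rfl⟩ := hf.2 y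
    have hx : (e.symm (f a)).1 = i := hx
    have hy : (e.symm (f b)).1 = i := hy
    rw [hs] at hx hy
    exact (hadj _ _).2 ⟨fun h => hxy (h ▸ rfl), Or.inl (hx.trans hy.symm)⟩
  refine isStrongClique_of_two_cliques (P := {u | (e.symm u).1 = p.1 + 1})
    (Q := {u | (e.symm u).1 = p.1 + 2}) (a := f (p.1, 0)) (b := f (p.1, 1)) (c := f (p.1, 2))
    (hcl _) (hcl _) (hcl _) ?_ ?_ ?_ (hf.1.ne (by simp)) (hf.1.ne (by simp)) (hf.1.ne (by simp))
    ?_ ?_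
  · simp [hs]
  · simp [hs]
  · simp [hs]
  · intro u hu v hv w hw huv huw
    obtain ⟨a, rfl⟩ := hf.2 u
    obtain ⟨b, rfl⟩ := hf.2 v
    obtain ⟨c, rfl⟩ := hf.2 w
    rw [hadj] at huv huw
    change (e.symm (f b)).1 = (e.symm (f p)).1 at hv
    change (e.symm (f c)).1 = (e.symm (f p)).1 at hw
    change ¬ (e.symm (f a)).1 = (e.symm (f p)).1 at hu
    rw [hs, hs] at hv hw hu
    congr 1
    ext1 <;> grind
  · intro v _ u _
    obtain ⟨a, rfl⟩ := hf.2 u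
    change (e.symm (f a)).1 = (e.symm (f p)).1 ∨ (e.symm (f a)).1 = p.1 + 1 ∨
      (e.symm (f a)).1 = p.1 + 2
    rw [hs, hs]
    generalize a.1 = x
    generalize p.1 = y
    revert x y
    decide

theorem graphH_adj {n : ℕ} {p q : ZMod n × Fin 4} : (graphH n).Adj p q ↔ p ≠ q ∧
    (p.1 = q.1 ∨ (q.1 = p.1 + 1 ∧ ((p.2 = 2 ∧ q.2 = 0) ∨ (p.2 = 3 ∧ q.2 = 1))) ∨
      (p.1 = q.1 + 1 ∧ ((q.2 = 2 ∧ p.2 = 0) ∨ (q.2 = 3 ∧ p.2 = 1)))) := by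
  simp only [graphH, fromRel_adj]
  grind

theorem isLocalizable_graphH {n : ℕ} (hn : 2 ≤ n) : (graphH n).IsLocalizable := by
  have : NeZero n := ⟨by omega⟩
  have hcl : ∀ i, (graphH n).IsClique {u | u.1 = i} := by
    rintro _ x rfl y hy hxy
    exact graphH_adj.2 ⟨hxy, Or.inl hy.symm⟩
  refine isLocalizable_of_label Prod.fst fun v =>
    isStrongClique_of_two_cliques (P := {u | u.1 = v.1 + 1}) (Q := {u | u.1 = v.1 - 1})
      (a := (v.1, 0)) (b := (v.1, 1)) (c := (v.1, 2)) (hcl _) (hcl _) (hcl _) rfl rfl rfl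
      (by simp) (by simp) (by simp) ?_ ?_
  · rintro ⟨u, i⟩ hu ⟨x, j⟩ hx ⟨y, k⟩ hy h1 h2
    have hu : ¬ u = v.1 := hu
    have hx : x = v.1 := hx
    have hy : y = v.1 := hy
    rw [graphH_adj] at h1 h2
    ext1 <;> grind
  · rintro ⟨x, j⟩ hx ⟨y, k⟩ h1
    have hx : x = v.1 := hx
    rw [graphH_adj] at h1
    change y = v.1 ∨ y = v.1 + 1 ∨ y = v.1 - 1
    grind

theorem isLocalizable_boxProd {n : ℕ} (hn : 3 ≤ n) :
    ((cycleGraph 3).boxProd (cycleGraph n)).IsLocalizable := by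
  obtain ⟨m, rfl⟩ : ∃ m, n = m + 2 := ⟨n - 2, by omega⟩
  have h3 : ∀ i j : Fin 3, (cycleGraph 3).Adj i j ↔ i ≠ j := by decide
  have hcl : ∀ i, ((cycleGraph 3).boxProd (cycleGraph (m + 2))).IsClique {u | u.2 = i} := by
    rintro _ ⟨x, i⟩ rfl ⟨y, j⟩ hy hxy
    have hy : j = i := hy
    subst hy
    exact Or.inl ⟨(h3 _ _).2 (by simpa using hxy), rfl⟩
  refine isLocalizable_of_label Prod.snd fun v =>
    isStrongClique_of_two_cliques (P := {u | u.2 = v.2 + 1}) (Q := {u | u.2 = v.2 - 1})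
      (a := (0, v.2)) (b := (1, v.2)) (c := (2, v.2)) (hcl _) (hcl _) (hcl _) rfl rfl rfl
      (by simp) (by simp) (by simp) ?_ ?_
  · rintro ⟨i, u⟩ hu ⟨j, x⟩ hx ⟨k, y⟩ hy h1 h2
    have hu : ¬ u = v.2 := hu
    have hx : x = v.2 := hx
    have hy : y = v.2 := hy
    rw [boxProd_adj] at h1 h2
    ext1 <;> grind
  · rintro ⟨j, x⟩ hx ⟨k, y⟩ h1
    have hx : x = v.2 := hx
    rw [boxProd_adj, cycleGraph_adj] at h1
    change y = v.2 ∨ y = v.2 + 1 ∨ y = v.2 - 1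
    subst hx
    rcases h1 with h1 | ⟨h1 | h1, -⟩
    · exact Or.inl h1.2.symm
    · exact Or.inr (Or.inr (by rw [← h1]; simp))
    · exact Or.inr (Or.inl (by rw [← h1]; simp))

theorem addCayley_pm_adj {k : ℕ} {a b : ZMod (3 * k)} :
    (addCayley ({1, -1, (k : ZMod (3 * k)), -(k : ZMod (3 * k))} : Set (ZMod (3 * k)))).Adj a b ↔
      a ≠ b ∧ (b = a + 1 ∨ a = b + 1 ∨ b = a + k ∨ a = b + k) := by
  rw [addCayley_adj]
  simp only [Set.mem_insert_iff, Set.mem_singleton_iff]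
  grind

theorem isLocalizable_addCayley {k : ℕ} (hk : 2 ≤ k) :
    (addCayley ({1, -1, (k : ZMod (3 * k)), -(k : ZMod (3 * k))} :
      Set (ZMod (3 * k)))).IsLocalizable := by
  have hk0 : NeZero (3 * k) := ⟨by omega⟩
  set H := addCayley ({1, -1, (k : ZMod (3 * k)), -(k : ZMod (3 * k))} :
      Set (ZMod (3 * k))) with hH
  have hadj : ∀ a b, H.Adj a b ↔ a ≠ b ∧ (b = a + 1 ∨ a = b + 1 ∨ b = a + k ∨ a = b + k) :=
    fun a b => addCayley_pm_adj
  let g : ZMod (3 * k) →+* ZMod k := ZMod.castHom (Dvd.intro_left 3 rfl) (ZMod k)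
  have h3 : (k : ZMod (3 * k)) + k + k = 0 := by
    have : ((3 * k : ℕ) : ZMod (3 * k)) = 0 := ZMod.natCast_self _
    push_cast at this
    linear_combination this
  have hg : ∀ a b, g a = g b → a = b ∨ a = b + k ∨ b = a + k := by
    intro a b h
    have h0 : g (a - b) = 0 := by simp [h]
    obtain ⟨c, hc⟩ : ∃ c : ℕ, (c : ZMod (3 * k)) = a - b ∧ c < 3 * k :=
      ⟨(a - b).val, ZMod.natCast_zmod_val _, ZMod.val_lt _⟩
    rw [← hc.1, map_natCast, ZMod.natCast_eq_zero_iff] at h0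
    obtain ⟨d, rfl⟩ := h0
    have hd : d < 3 := by
      have := hc.2
      rw [mul_comm 3 k] at this
      exact lt_of_mul_lt_mul_left this (Nat.zero_le _)
    have h1 := hc.1
    interval_cases d
    · left; push_cast at h1; linear_combination -h1
    · right; left; push_cast at h1; linear_combination -h1
    · right; right; push_cast at h1; linear_combination h1 - h3
  have hcl : ∀ i, H.IsClique {u | g u = i} := by
    rintro _ x rfl y hy hxy
    have := hg y x hy
    rw [hadj]
    grind
  have hne : ∀ c : ℕ, 0 < c → c < 3 * k → (c : ZMod (3 * k)) ≠ 0 := by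
    intro c h0 h1 h2
    rw [ZMod.natCast_eq_zero_iff] at h2
    exact absurd (Nat.le_of_dvd h0 h2) (by omega)
  have hk0 : (k : ZMod (3 * k)) ≠ 0 := hne k (by omega) (by omega)
  have hk1 : (k : ZMod (3 * k)) + k ≠ 0 := by
    have := hne (k + k) (by omega) (by omega)
    push_cast at this
    exact this
  refine isLocalizable_of_label g fun v => ?_
  have e1 : g (v + k) = g v := by simp
  have e2 : g (v + k + k) = g v := by simp
  -- for `k = 2` the strong triangles are checked in `ZMod 6`, which is definitionally `Fin 6`
  have key : ∀ v p q r : Fin 6, (p = v + 1 ∨ v = p + 1 ∨ p = v + 2 ∨ v = p + 2) →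
      (q = v + 2 + 1 ∨ v + 2 = q + 1 ∨ q = v + 2 + 2 ∨ v + 2 = q + 2) →
      (r = v + 2 + 2 + 1 ∨ v + 2 + 2 = r + 1 ∨ r = v + 2 + 2 + 2 ∨ v + 2 + 2 = r + 2) →
      (p ≠ q ∧ (q = p + 1 ∨ p = q + 1 ∨ q = p + 2 ∨ p = q + 2)) ∨
      (q ≠ r ∧ (r = q + 1 ∨ q = r + 1 ∨ r = q + 2 ∨ q = r + 2)) ∨
      (p ≠ r ∧ (r = p + 1 ∨ p = r + 1 ∨ r = p + 2 ∨ p = r + 2)) := by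
    decide
  rcases Nat.lt_or_ge k 3 with hk2 | hk3
  · obtain rfl : k = 2 := by omega
    refine isStrongClique_of_triangle (a := v) (b := v + 2) (c := v + 2 + 2) (hcl _) rfl e1 e2 ?_
    intro p q r hp hq hr
    rw [hadj] at hp hq hr
    simp only [hadj]
    exact key v p q r hp.2 hq.2 hr.2
  · refine isStrongClique_of_two_cliques (P := {u | g u = g v + 1}) (Q := {u | g u = g v - 1})
      (a := v) (b := v + k) (c := v + k + k) (hcl _) (hcl _) (hcl _) rfl e1 e2
      (by grind) (by grind) (by grind) ?_ ?_
    · intro u hu x hx y hy hux huy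
      have hx : g x = g v := hx
      have hy : g y = g v := hy
      have hu : ¬ g u = g v := hu
      rw [hadj] at hux huy
      have h2 : (2 : ZMod k) ≠ 0 := by
        intro h
        have : ((2 : ℕ) : ZMod k) = 0 := by exact_mod_cast h
        rw [ZMod.natCast_eq_zero_iff] at this
        exact absurd (Nat.le_of_dvd (by omega) this) (by omega)
      -- a neighbour of `u` outside the class of `u` is `u + 1` or `u - 1`
      have hstep : ∀ z, g z = g v → (z = u + 1 ∨ u = z + 1 ∨ z = u + k ∨ u = z + k) →
          z = u + 1 ∨ u = z + 1 := by
        rintro z hz (h | h | rfl | rfl)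
        · exact Or.inl h
        · exact Or.inr h
        · exact absurd (by simpa using hz) hu
        · exact absurd (by simpa using hz) hu
      rcases hstep x hx hux.2 with rfl | h1 <;> rcases hstep y hy huy.2 with h3 | h3
      · exact h3.symm
      · subst h3
        simp only [map_add, map_one] at hx hy
        exact absurd (by linear_combination hx - hy) h2
      · subst h3
        rw [h1] at hy
        simp only [map_add, map_one] at hx hy
        exact absurd (by linear_combination hy - hx) h2
      · exact add_right_cancel (h1.symm.trans h3)
    · intro x hx y hxy
      have hx : g x = g v := hx
      change g y = g v ∨ g y = g v + 1 ∨ g y = g v - 1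
      rcases ((hadj _ _).1 hxy).2 with rfl | rfl | rfl | rfl
      · simp [hx]
      · simp [← hx]
      · simp [hx]
      · simp [← hx]

/-! ### Reduction to connected graphs -/

theorem isVertexTransitive_toSimpleGraph (hvt : G.IsVertexTransitive) (c : G.ConnectedComponent) :
    c.toSimpleGraph.IsVertexTransitive := by
  rintro ⟨u, hu⟩ ⟨v, hv⟩
  obtain ⟨φ, rfl⟩ := hvt u v
  have hφ : ∀ x, x ∈ c.supp ↔ φ x ∈ c.supp := by
    intro x
    have hu : G.connectedComponentMk u = c := hu
    have hv : G.connectedComponentMk (φ u) = c := hv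
    change G.connectedComponentMk x = c ↔ G.connectedComponentMk (φ x) = c
    conv_lhs => rw [← hu]
    rw [← hv, ConnectedComponent.eq, ConnectedComponent.eq, φ.reachable_iff]
  exact ⟨⟨φ.toEquiv.subtypeEquiv hφ, fun {x y} => φ.map_adj_iff⟩, rfl⟩

theorem IsFourValent.toSimpleGraph (h : G.IsFourValent) (c : G.ConnectedComponent) :
    c.toSimpleGraph.IsFourValent := by
  rintro ⟨v, hv⟩
  obtain ⟨p, q, r, s, h1, h2, h3, h4, h5, h6, hx⟩ := h v
  have hm : ∀ x, G.Adj v x → x ∈ c.supp := fun x hx =>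
    (ConnectedComponent.mem_supp_congr_adj c hx).1 hv
  refine ⟨⟨p, hm p (by simp [hx])⟩, ⟨q, hm q (by simp [hx])⟩, ⟨r, hm r (by simp [hx])⟩,
    ⟨s, hm s (by simp [hx])⟩, by simpa, by simpa, by simpa, by simpa, by simpa, by simpa, ?_⟩
  rintro ⟨x, hxc⟩
  simpa [ConnectedComponent.toSimpleGraph] using hx x

theorem IsStrongClique.toSimpleGraph [Finite V] {C : Set V} (hC : G.IsStrongClique C) {v : V}
    (hv : v ∈ C) :
    (G.connectedComponentMk v).toSimpleGraph.IsStrongClique (Subtype.val ⁻¹' C) := by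
  rw [isStrongClique_iff] at hC ⊢
  refine ⟨fun x hx y hy hxy => hC.1 hx hy (fun e => hxy (Subtype.ext e)), fun D hD => ?_⟩
  obtain ⟨x, hx, hxD⟩ := hC.2 (Subtype.val '' D) (by
    rintro _ ⟨a, ha, rfl⟩ _ ⟨b, hb, rfl⟩ hab
    exact hD ha hb fun e => hab (e ▸ rfl))
  have hxv : x ∈ (G.connectedComponentMk v).supp := by
    by_cases e : x = v
    · subst e; rfl
    · exact (ConnectedComponent.mem_supp_congr_adj _ (hC.1 hv hx (Ne.symm e))).1 rfl
  exact ⟨⟨x, hxv⟩, hx, fun d hd hadj => hxD d ⟨d, hd, rfl⟩ hadj⟩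

theorem IsStrongClique.of_toSimpleGraph [Finite V] {c : G.ConnectedComponent} {C : Set c}
    (hC : c.toSimpleGraph.IsStrongClique C) : G.IsStrongClique (Subtype.val '' C) := by
  rw [isStrongClique_iff] at hC ⊢
  refine ⟨?_, fun D hD => ?_⟩
  · rintro _ ⟨a, ha, rfl⟩ _ ⟨b, hb, rfl⟩ hab
    exact hC.1 ha hb fun e => hab (e ▸ rfl)
  · obtain ⟨x, hx, hxD⟩ := hC.2 (Subtype.val ⁻¹' D)
      fun a ha b hb hab => hD ha hb fun e => hab (Subtype.ext e)
    refine ⟨x, ⟨x, hx, rfl⟩, fun d hd hadj => ?_⟩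
    exact hxD ⟨d, (ConnectedComponent.mem_supp_congr_adj c hadj).1 x.2⟩ hd hadj

/-- The components of a vertex-transitive graph are isomorphic, so a localization of one of them
can be copied to all the others. -/
theorem IsVertexTransitive.isLocalizable_of_component [Finite V] (hvt : G.IsVertexTransitive)
    (c : G.ConnectedComponent) (h : c.toSimpleGraph.IsLocalizable) : G.IsLocalizable := by
  obtain ⟨f, hf⟩ := isLocalizable_iff.1 h
  obtain ⟨v₀, hv₀⟩ : ∃ v, G.connectedComponentMk v = c := c.exists_rep
  have hex : ∀ d : G.ConnectedComponent, ∃ φ : G ≃g G, G.connectedComponentMk (φ v₀) = d := by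
    intro d
    obtain ⟨w, rfl⟩ := d.exists_rep
    obtain ⟨φ, hφ⟩ := hvt v₀ w
    exact ⟨φ, by rw [hφ]; rfl⟩
  choose φ hφ using hex
  have hmem : ∀ v, (φ (G.connectedComponentMk v)).symm v ∈ c := by
    intro v
    change G.connectedComponentMk _ = c
    rw [← hv₀, ConnectedComponent.eq, ← (φ (G.connectedComponentMk v)).reachable_iff,
      RelIso.apply_symm_apply, ← ConnectedComponent.eq, hφ]
  refine isLocalizable_iff.2 ⟨fun v => φ (G.connectedComponentMk v) ''
    (Subtype.val '' f ⟨(φ (G.connectedComponentMk v)).symm v, hmem v⟩), fun v => ⟨?_, ?_, ?_⟩⟩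
  · exact ⟨_, ⟨_, (hf _).1, rfl⟩, RelIso.apply_symm_apply _ _⟩
  · exact (hf _).2.1.of_toSimpleGraph.image _
  · rintro _ ⟨_, ⟨u, hu, rfl⟩, rfl⟩
    have e : G.connectedComponentMk (φ (G.connectedComponentMk v) u) =
        G.connectedComponentMk v := by
      refine Eq.trans ?_ (hφ (G.connectedComponentMk v))
      rw [ConnectedComponent.eq, Iso.reachable_iff, ← ConnectedComponent.eq, hv₀]
      exact u.2
    dsimp only
    have e2 : (⟨(φ (G.connectedComponentMk (φ (G.connectedComponentMk v) u))).symm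
        (φ (G.connectedComponentMk v) u), hmem _⟩ : c) = u := by
      apply Subtype.ext
      simp [e]
    rw [e2, e, (hf _).2.2 u hu]

/-! ### Complete graphs, complete bipartite graphs and twins -/

theorem injective_vec4 {a b c d : V} (hab : a ≠ b) (hac : a ≠ c) (had : a ≠ d) (hbc : b ≠ c)
    (hbd : b ≠ d) (hcd : c ≠ d) : Function.Injective ![a, b, c, d] := by
  intro i j h
  fin_cases i <;> fin_cases j <;> simp_all

theorem IsFourValent.nonempty_iso_completeGraph (h : G.IsFourValent) (hc : G.Connected)
    {a b c d e : V} (hab : G.Adj a b) (hac : G.Adj a c) (had : G.Adj a d) (hae : G.Adj a e)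
    (hbc : G.Adj b c) (hbd : G.Adj b d) (hbe : G.Adj b e) (hcd : G.Adj c d) (hce : G.Adj c e)
    (hde : G.Adj d e) : Nonempty (G ≃g completeGraph (Fin 5)) := by
  have hom : ∀ i j : Fin 5, i ≠ j → G.Adj (![a, b, c, d, e] i) (![a, b, c, d, e] j) := by
    intro i j hij
    fin_cases i <;> fin_cases j <;> simp_all [G.adj_comm]
  refine h.nonempty_iso hc ![a, b, c, d, e] (fun i j hij => ?_) (fun i j hij => hom i j hij) ?_
  · by_contra hn
    exact (hom i j hn).ne hij
  · simp only [completeGraph, top_adj]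
    decide

/-- A strong edge in a 4-valent graph: every neighbour of one end is adjacent to every
neighbour of the other end. -/
theorem IsFourValent.nonempty_iso_completeBipartiteGraph [Finite V] (h : G.IsFourValent)
    (hc : G.Connected) {a b : V} (hs : G.IsStrongClique {a, b}) :
    Nonempty (G ≃g completeBipartiteGraph (Fin 4) (Fin 4)) := by
  have key : ∀ p q, G.Adj a p → G.Adj b q → G.Adj p q := by
    intro p q hp hq
    by_contra hn
    obtain ⟨x, hx, hD⟩ := (isStrongClique_iff.1 hs).2 {p, q} (by
      rintro x (rfl | rfl) y (rfl | rfl) hxy hadj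
      exacts [hxy rfl, hn hadj, hn hadj.symm, hxy rfl])
    rcases hx with rfl | rfl
    · exact hD p (by simp) hp
    · exact hD q (by simp) hq
  obtain ⟨p, q, r, s, h1, h2, h3, h4, h5, h6, ha⟩ := h a
  obtain ⟨p', q', r', s', h1', h2', h3', h4', h5', h6', hb⟩ := h b
  have hom : ∀ i j, G.Adj (![p, q, r, s] i) (![p', q', r', s'] j) := by
    intro i j
    apply key
    · fin_cases i <;> simp [ha]
    · fin_cases j <;> simp [hb]
  refine h.nonempty_iso hc (Sum.elim ![p, q, r, s] ![p', q', r', s'])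
    ((injective_vec4 h1 h2 h3 h4 h5 h6).sumElim (injective_vec4 h1' h2' h3' h4' h5' h6')
      fun i j => (hom i j).ne) ?_ ?_
  · rintro (i | i) (j | j) hij <;> simp at hij
    · exact hom i j
    · exact (hom j i).symm
  · rintro (i | i)
    · exact ⟨.inr 0, .inr 1, .inr 2, .inr 3, by simp⟩
    · exact ⟨.inl 0, .inl 1, .inl 2, .inl 3, by simp⟩

/-- Two vertices are (closed) twins if they have the same closed neighbourhood. -/
def IsTwin (G : SimpleGraph V) (u v : V) : Prop :=
  ∀ x, (x = u ∨ G.Adj u x) ↔ (x = v ∨ G.Adj v x)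

theorem IsTwin.map {u v : V} (h : G.IsTwin u v) (φ : G ≃g G) : G.IsTwin (φ u) (φ v) := by
  intro x
  obtain ⟨x, rfl⟩ := φ.surjective x
  simpa [φ.map_adj_iff] using h x

/-- The twin classes of a vertex-transitive graph have equal size and partition every closed
neighbourhood.  In a 4-valent graph their size divides five, so there are no twins except in the
complete graph on five vertices. -/
theorem IsFourValent.not_isTwin (h : G.IsFourValent) (hvt : G.IsVertexTransitive)
    (hc : G.Connected) (hK : ¬ Nonempty (G ≃g completeGraph (Fin 5))) {a b : V} (hab : a ≠ b) :
    ¬ G.IsTwin a b := by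
  intro ht
  have symm : ∀ {u v}, G.IsTwin u v → G.IsTwin v u := fun h x => (h x).symm
  have trans : ∀ {u v w}, G.IsTwin u v → G.IsTwin v w → G.IsTwin u w :=
    fun h h' x => (h x).trans (h' x)
  have tadj : ∀ {u v}, u ≠ v → G.IsTwin u v → G.Adj u v := fun {u v} hn h =>
    ((h v).2 (Or.inl rfl)).resolve_left hn.symm
  have one : ∀ v, ∃ u, v ≠ u ∧ G.IsTwin v u := by
    intro v
    obtain ⟨φ, rfl⟩ := hvt a v
    exact ⟨φ b, fun e => hab (φ.injective e), ht.map φ⟩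
  have hall : ∀ v, ¬ ∀ u, G.Adj v u → G.IsTwin v u := by
    intro v hv
    obtain ⟨p, q, r, s, h1, h2, h3, h4, h5, h6, hx⟩ := h v
    have tp := hv p (by simp [hx])
    have tq := hv q (by simp [hx])
    have tr := hv r (by simp [hx])
    have ts := hv s (by simp [hx])
    exact hK (h.nonempty_iso_completeGraph hc (a := v) (b := p) (c := q) (d := r) (e := s)
      (by simp [hx]) (by simp [hx]) (by simp [hx]) (by simp [hx])
      (tadj h1 (trans (symm tp) tq)) (tadj h2 (trans (symm tp) tr)) (tadj h3 (trans (symm tp) ts))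
      (tadj h4 (trans (symm tq) tr)) (tadj h5 (trans (symm tq) ts)) (tadj h6 (trans (symm tr) ts)))
  -- three mutual twins: every other vertex of the closed neighbourhood has two twins in it
  have two : ∀ {u v w}, u ≠ v → u ≠ w → v ≠ w → G.IsTwin u v → G.IsTwin u w → False := by
    intro u v w huv huw hvw h1 h2
    have two : ∀ z, ∃ x y, z ≠ x ∧ z ≠ y ∧ x ≠ y ∧ G.IsTwin z x ∧ G.IsTwin z y := by
      intro z
      obtain ⟨φ, rfl⟩ := hvt u z
      exact ⟨φ v, φ w, fun e => huv (φ.injective e), fun e => huw (φ.injective e),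
        fun e => hvw (φ.injective e), h1.map φ, h2.map φ⟩
    obtain ⟨r, s, n1, n2, n3, n4, n5, hx⟩ := h.two (tadj huv h1) (tadj huw h2) hvw
    have near : ∀ z, G.Adj u z → ∀ y, G.IsTwin z y → y = u ∨ G.Adj u y := fun z hz y hy => by
      have h3 := (hy u).1 (Or.inr hz.symm)
      exact h3.imp Eq.symm fun h => h.symm
    have hr : G.IsTwin u r := by
      obtain ⟨x, y, m1, m2, m3, t1, t2⟩ := two r
      have := near r (by simp [hx]) x t1
      have := near r (by simp [hx]) y t2
      grind
    have hs : G.IsTwin u s := by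
      obtain ⟨x, y, m1, m2, m3, t1, t2⟩ := two s
      have := near s (by simp [hx]) x t1
      have := near s (by simp [hx]) y t2
      grind
    refine hall u fun z hz => ?_
    rw [hx] at hz
    rcases hz with rfl | rfl | rfl | rfl <;> assumption
  obtain ⟨c, d, e, n1, n2, n3, n4, n5, n6, hx⟩ := h.one (tadj hab ht)
  have near : ∀ z, G.Adj a z → ∀ y, G.IsTwin z y → y = a ∨ G.Adj a y := fun z hz y hy => by
    have h3 := (hy a).1 (Or.inr hz.symm)
    exact h3.imp Eq.symm fun h => h.symm
  obtain ⟨c', m1, t1⟩ := one c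
  obtain ⟨d', m2, t2⟩ := one d
  obtain ⟨e', m3, t3⟩ := one e
  have u1 := near c (by simp [hx]) c' t1
  have u2 := near d (by simp [hx]) d' t2
  have u3 := near e (by simp [hx]) e' t3
  rw [hx] at u1 u2 u3
  have nc : a ≠ c := (show G.Adj a c by simp [hx]).ne
  have nd : a ≠ d := (show G.Adj a d by simp [hx]).ne
  have ne : a ≠ e := (show G.Adj a e by simp [hx]).ne
  have fc : ¬ G.IsTwin a c := fun h => two hab nc n1 ht h
  have fd : ¬ G.IsTwin a d := fun h => two hab nd n2 ht h
  have fe : ¬ G.IsTwin a e := fun h => two hab ne n3 ht h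
  have hc' : c' = d ∨ c' = e := by grind
  have hd' : d' = c ∨ d' = e := by grind
  have he' : e' = c ∨ e' = d := by grind
  grind

/-! ### Strong cliques of size four: the graphs `H_n` -/

/-- A sequence in a finite type whose terms differ from the next two terms has a stretch of
length at least three that consists of distinct terms and closes up. -/
theorem exists_closed_stretch {α : Type*} [Finite α] (t : ℕ → α) (h1 : ∀ i, t i ≠ t (i + 1))
    (h2 : ∀ i, t i ≠ t (i + 2)) :
    ∃ i n, 3 ≤ n ∧ t (i + n) = t i ∧ ∀ k l, k < n → l < n → t (i + k) = t (i + l) → k = l := by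
  classical
  have hex : ∃ n, 0 < n ∧ ∃ i, t (i + n) = t i := by
    obtain ⟨i, j, hij, h⟩ := Finite.exists_ne_map_eq_of_infinite t
    rcases lt_or_gt_of_ne hij with h' | h'
    · exact ⟨j - i, by omega, i, by rw [Nat.add_sub_cancel' h'.le, h]⟩
    · exact ⟨i - j, by omega, j, by rw [Nat.add_sub_cancel' h'.le, h]⟩
  obtain ⟨hn, i, hi⟩ := Nat.find_spec hex
  have hmin : ∀ m, 0 < m → m < Nat.find hex → ∀ i, t (i + m) ≠ t i := fun m h0 hm i hi =>
    Nat.find_min hex hm ⟨h0, i, hi⟩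
  set n := Nat.find hex
  refine ⟨i, n, ?_, hi, ?_⟩
  · by_contra! h3
    interval_cases n
    · exact h1 i hi.symm
    · exact h2 i hi.symm
  · intro k l hk hl h
    by_contra hne
    rcases lt_or_gt_of_ne hne with h' | h'
    · exact hmin (l - k) (by omega) (by omega) (i + k)
        (by rw [add_assoc, Nat.add_sub_cancel' h'.le, h])
    · exact hmin (k - l) (by omega) (by omega) (i + l)
        (by rw [add_assoc, Nat.add_sub_cancel' h'.le, h])

/-- It suffices to find a cyclic sequence of disjoint 4-cliques, consecutive ones being joined by
two edges as in `H_n`. -/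
theorem IsFourValent.nonempty_iso_graphH_of_layers (h : G.IsFourValent) (hc : G.Connected) {n : ℕ}
    (hn : 2 ≤ n) (F : ZMod n → Fin 4 → V) (hadj : ∀ k i j, i ≠ j → G.Adj (F k i) (F k j))
    (hF : ∀ k l i j, F k i = F l j → k = l)
    (h20 : ∀ k, G.Adj (F k 2) (F (k + 1) 0)) (h31 : ∀ k, G.Adj (F k 3) (F (k + 1) 1)) :
    Nonempty (G ≃g graphH n) := by
  have : Fact (1 < n) := ⟨hn⟩
  have hne : ∀ k : ZMod n, k ≠ k - 1 := fun k hk => by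
    have h1 : k + 1 = k := by nth_rw 1 [hk]; exact sub_add_cancel k 1
    simp at h1
  refine h.nonempty_iso hc (fun q => F q.1 q.2) ?_ ?_ ?_
  · rintro ⟨k, i⟩ ⟨l, j⟩ hkl
    obtain rfl := hF k l i j hkl
    by_contra hij
    exact (hadj k i j fun e => hij (e ▸ rfl)).ne hkl
  · rintro ⟨k, i⟩ ⟨l, j⟩ hkl
    rw [graphH_adj] at hkl
    dsimp only at hkl ⊢
    rcases hkl with ⟨hne, rfl | ⟨rfl, ⟨rfl, rfl⟩ | ⟨rfl, rfl⟩⟩ | ⟨rfl, ⟨rfl, rfl⟩ | ⟨rfl, rfl⟩⟩⟩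
    · exact hadj _ _ _ fun e => hne (e ▸ rfl)
    · exact h20 k
    · exact h31 k
    · exact (h20 l).symm
    · exact (h31 l).symm
  · rintro ⟨k, i⟩
    fin_cases i
    · refine ⟨(k, 1), (k, 2), (k, 3), (k - 1, 2), ?_⟩
      simp [graphH_adj, hne]
    · refine ⟨(k, 0), (k, 2), (k, 3), (k - 1, 3), ?_⟩
      simp [graphH_adj, hne]
    · refine ⟨(k, 0), (k, 1), (k, 3), (k + 1, 0), ?_⟩
      simp [graphH_adj]
    · refine ⟨(k, 0), (k, 1), (k, 2), (k + 1, 1), ?_⟩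
      simp [graphH_adj]

/-- A connected graph whose edges are those of a partition into 4-cliques (the classes of `S`) and
of a perfect matching `m` is some `H_n` if every vertex has a clique mate matched into the same
clique as itself.  Either the two matching edges are part of four between the same two cliques, or
the matching edges pair up, and the cliques are arranged in a cycle. -/
theorem IsFourValent.nonempty_iso_graphH_of_matching [Finite V] (h : G.IsFourValent)
    (hc : G.Connected) (m : V → V) (S : Setoid V) (hm : ∀ v, m (m v) = v) (hSm : ∀ v, ¬ S v (m v))
    (hadj : ∀ u v, G.Adj u v ↔ (S u v ∧ u ≠ v) ∨ v = m u)
    (hcl : ∀ v, ∃ b c d, v ≠ b ∧ v ≠ c ∧ v ≠ d ∧ b ≠ c ∧ b ≠ d ∧ c ≠ d ∧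
      ∀ x, S v x ↔ x = v ∨ x = b ∨ x = c ∨ x = d)
    (hP : ∀ v, ∃ u, v ≠ u ∧ S v u ∧ S (m v) (m u)) :
    ∃ n, 2 ≤ n ∧ Nonempty (G ≃g graphH n) := by
  have hmi : Function.Injective m := Function.LeftInverse.injective hm
  have refl : ∀ {u}, S u u := fun {u} => S.refl u
  have symm : ∀ {u v}, S u v → S v u := fun h => S.symm h
  have trans : ∀ {u v w}, S u v → S v w → S u w := fun h h' => S.trans h h'
  by_cases hA : ∃ v b c, v ≠ b ∧ v ≠ c ∧ b ≠ c ∧ S v b ∧ S v c ∧ S (m v) (m b) ∧ S (m v) (m c)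
  · obtain ⟨v, b, c, hvb, hvc, hbc, sb, sc, tb, tc⟩ := hA
    obtain ⟨d, hvd, hbd, hcd, sd⟩ : ∃ d, v ≠ d ∧ b ≠ d ∧ c ≠ d ∧ S v d := by
      obtain ⟨b', c', d', h1, h2, h3, h4, h5, h6, h7⟩ := hcl v
      have hb := (h7 b).1 sb
      have hc := (h7 c).1 sc
      by_contra! hn
      have k1 := hn b'
      have k2 := hn c'
      have k3 := hn d'
      grind
    have hd : ∀ x, S v x → x = v ∨ x = b ∨ x = c ∨ x = d := by
      obtain ⟨b', c', d', h1, h2, h3, h4, h5, h6, h7⟩ := hcl v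
      have hb := (h7 b).1 sb
      have hc := (h7 c).1 sc
      have hd := (h7 d).1 sd
      intro x hx
      rw [h7] at hx
      grind
    have td : S (m v) (m d) := by
      obtain ⟨u, hu, su, tu⟩ := hP d
      rcases hd u (trans sd su) with rfl | rfl | rfl | rfl
      · exact symm tu
      · exact trans tb (symm tu)
      · exact trans tc (symm tu)
      · exact absurd rfl hu
    have s0 : ∀ i, S v (![v, b, c, d] i) := by
      intro i
      fin_cases i
      exacts [refl, sb, sc, sd]
    have s1 : ∀ i, S (m v) (![m c, m d, m v, m b] i) := by
      intro i
      fin_cases i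
      exacts [tc, td, refl, tb]
    have i0 := injective_vec4 hvb hvc hvd hbc hbd hcd
    have i1 := injective_vec4 (hmi.ne hcd) (hmi.ne hvc.symm) (hmi.ne hbc.symm) (hmi.ne hvd.symm)
      (hmi.ne hbd.symm) (hmi.ne hvb)
    let F : Fin 2 → Fin 4 → V := ![![v, b, c, d], ![m c, m d, m v, m b]]
    refine ⟨2, le_rfl, h.nonempty_iso_graphH_of_layers hc le_rfl F ?_ ?_ ?_ ?_⟩
    · intro k i j hij
      rw [hadj]
      left
      change Fin 2 at k
      fin_cases k
      · exact ⟨trans (symm (s0 i)) (s0 j), i0.ne hij⟩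
      · exact ⟨trans (symm (s1 i)) (s1 j), i1.ne hij⟩
    · intro k l i j hkl
      change Fin 2 at k l
      fin_cases k <;> fin_cases l
      · rfl
      · refine absurd (trans (s0 i) ?_) (hSm v)
        change S (F 0 i) (m v)
        rw [show F 0 i = F 1 j from hkl]
        exact symm (s1 j)
      · refine absurd (trans (s0 j) ?_) (hSm v)
        change S (F 0 j) (m v)
        rw [show F 0 j = F 1 i from hkl.symm]
        exact symm (s1 i)
      · rfl
    · intro k
      rw [hadj]
      right
      change Fin 2 at k
      fin_cases k
      · rfl
      · exact (hm v).symm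
    · intro k
      rw [hadj]
      right
      change Fin 2 at k
      fin_cases k
      · rfl
      · exact (hm b).symm
  · push Not at hA
    choose p hp1 hp2 hp3 using hP
    have huniq : ∀ {v u}, v ≠ u → S v u → S (m v) (m u) → u = p v := fun {v u} h1 h2 h3 => by
      by_contra hn
      exact hA v u (p v) h1 (hp1 v) hn h2 (hp2 v) h3 (hp3 v)
    have hpp : ∀ v, p (p v) = v := fun v =>
      (huniq (hp1 v).symm (symm (hp2 v)) (symm (hp3 v))).symm
    have hpm : ∀ v, p (m v) = m (p v) := fun v =>
      (huniq (hmi.ne (hp1 v)) (hp3 v) (by rw [hm, hm]; exact hp2 v)).symm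
    have he : ∀ v, ∃ e, S v e ∧ e ≠ v ∧ e ≠ p v := by
      intro v
      obtain ⟨b, c, d, h1, h2, h3, h4, h5, h6, h7⟩ := hcl v
      by_contra! hn
      have k1 := hn b
      have k2 := hn c
      grind
    choose e he1 he2 he3 using he
    -- leave each clique through an edge not parallel to the one through which it was entered
    let z : ℕ → V := fun i => Nat.rec (motive := fun _ => V) hc.nonempty.some
      (fun _ x => e (m x)) i
    have hz : ∀ i, z (i + 1) = e (m (z i)) := fun i => rfl
    have hzm : ∀ i, S (m (z i)) (z (i + 1)) := fun i => he1 _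
    have hz1 : ∀ i, ¬ S (z i) (z (i + 1)) := fun i hs => hSm _ (trans hs (symm (hzm i)))
    have hz2 : ∀ i, ¬ S (z i) (z (i + 2)) := by
      intro i hs
      refine he3 (m (z i)) (huniq (he2 _).symm (he1 _) ?_)
      rw [hm]
      exact trans hs (symm (hzm (i + 1)))
    obtain ⟨i, n, hn, hin, hinj⟩ := exists_closed_stretch (fun i => Quotient.mk S (z i))
      (fun i hi => hz1 i (Quotient.exact hi)) (fun i hi => hz2 i (Quotient.exact hi))
    replace hin : S (z (i + n)) (z i) := Quotient.exact hin
    replace hinj : ∀ k l, k < n → l < n → S (z (i + k)) (z (i + l)) → k = l :=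
      fun k l hk hl hs => hinj k l hk hl (Quotient.sound hs)
    have : NeZero n := ⟨by omega⟩
    let X : ℕ → V := fun k => if k = 0 then m (z (i + (n - 1))) else m (z (i + (k - 1)))
    have hX0 : X 0 = m (z (i + (n - 1))) := rfl
    have hX1 : ∀ k, X (k + 1) = m (z (i + k)) := fun k => rfl
    have hXS : ∀ k, S (z (i + k)) (X k) := by
      rintro (_ | k)
      · rw [hX0]
        refine trans (symm hin) (symm ?_)
        have := hzm (i + (n - 1))
        rwa [show i + (n - 1) + 1 = i + n by omega] at this
      · exact symm (hzm (i + k))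
    have hXz : ∀ k, X k ≠ z (i + k) ∧ X k ≠ p (z (i + k)) := by
      rintro (_ | k)
      · have h1 : ¬ S (z (i + (n - 1))) (m (z i)) := fun hs => by
          have := hinj (n - 1) 1 (by omega) (by omega) (trans hs (hzm i))
          omega
        rw [hX0]
        refine ⟨fun hx => h1 ?_, fun hx => h1 ?_⟩
        · rw [add_zero] at hx
          rw [← hx, hm]
        · rw [add_zero] at hx
          rw [← hpp (z i), ← hx, hpm, hm]
          exact hp2 _
      · rw [hX1]
        refine ⟨(he2 _).symm, fun hx => he3 (m (z (i + k))) ?_⟩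
        change _ = p (z (i + k + 1)) at hx
        rw [← hz, ← hpp (z (i + k + 1)), ← hx]
    let F : ZMod n → Fin 4 → V := fun k =>
      ![X k.val, p (X k.val), z (i + k.val), p (z (i + k.val))]
    have hFS : ∀ k j, S (z (i + k.val)) (F k j) := by
      intro k j
      fin_cases j
      exacts [hXS _, trans (hXS _) (hp2 _), refl, hp2 _]
    have hFi : ∀ k, Function.Injective (F k) := by
      intro k
      have h1 := hXz k.val
      refine injective_vec4 (hp1 _) h1.1 h1.2 (fun hx => h1.2 ?_) (fun hx => h1.1 ?_) (hp1 _)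
      · rw [← hx, hpp]
      · rw [← hpp (X _), hx, hpp]
    have hFX : ∀ k : ZMod n, X (k + 1).val = m (z (i + k.val)) := by
      intro k
      have hk := ZMod.val_lt k
      have : Fact (1 < n) := ⟨by omega⟩
      rw [ZMod.val_add, ZMod.val_one]
      rcases Nat.lt_or_ge (k.val + 1) n with h1 | h1
      · rw [Nat.mod_eq_of_lt h1, hX1]
      · rw [show k.val + 1 = n by omega, Nat.mod_self, hX0, show n - 1 = k.val by omega]
    refine ⟨n, by omega, h.nonempty_iso_graphH_of_layers hc (by omega) F ?_ ?_ ?_ ?_⟩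
    · intro k a b hab
      exact (hadj _ _).2 (Or.inl ⟨trans (symm (hFS k a)) (hFS k b), (hFi k).ne hab⟩)
    · intro k l a b hab
      refine ZMod.val_injective n (hinj _ _ (ZMod.val_lt k) (ZMod.val_lt l) ?_)
      refine trans (hFS k a) ?_
      rw [hab]
      exact symm (hFS l b)
    · intro k
      exact (hadj _ _).2 (Or.inr (hFX k))
    · intro k
      refine (hadj _ _).2 (Or.inr ?_)
      change p (X (k + 1).val) = m (p (z (i + k.val)))
      rw [hFX, hpm]

/-- A graph other than `K_5` with a strong clique of size four.  The neighbours outside the clique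
are not independent, so two vertices of the clique are matched into the same 4-clique. -/
theorem IsFourValent.nonempty_iso_graphH [Finite V] (h : G.IsFourValent)
    (hvt : G.IsVertexTransitive) (hc : G.Connected)
    (hK : ¬ Nonempty (G ≃g completeGraph (Fin 5))) {a b c d : V} (hab : a ≠ b) (hac : a ≠ c)
    (had : a ≠ d) (hbc : b ≠ c) (hbd : b ≠ d) (hcd : c ≠ d) (hs : G.IsStrongClique {a, b, c, d}) :
    ∃ n, 2 ≤ n ∧ Nonempty (G ≃g graphH n) := by
  have adj1 : G.Adj a b := hs.1 (by simp) (by simp) hab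
  have adj2 : G.Adj a c := hs.1 (by simp) (by simp) hac
  have adj3 : G.Adj a d := hs.1 (by simp) (by simp) had
  have adj4 : G.Adj b c := hs.1 (by simp) (by simp) hbc
  have adj5 : G.Adj b d := hs.1 (by simp) (by simp) hbd
  have adj6 : G.Adj c d := hs.1 (by simp) (by simp) hcd
  -- each vertex has one neighbour outside its 4-clique, which is adjacent to no other vertex of
  -- the clique because there are no twins
  have hex : ∀ v, ∃ b c d w, b ≠ c ∧ b ≠ d ∧ c ≠ d ∧ b ≠ w ∧ c ≠ w ∧ d ≠ w ∧
      G.Adj b c ∧ G.Adj b d ∧ G.Adj c d ∧ ¬ G.Adj w b ∧ ¬ G.Adj w c ∧ ¬ G.Adj w d ∧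
      ∀ x, G.Adj v x ↔ x = b ∨ x = c ∨ x = d ∨ x = w := by
    have twin : ∀ {v b c d w}, b ≠ c → b ≠ d → c ≠ d → b ≠ w → c ≠ w → d ≠ w →
        G.Adj b c → G.Adj b d → G.Adj v b →
        (∀ x, G.Adj v x ↔ x = b ∨ x = c ∨ x = d ∨ x = w) → ¬ G.Adj w b := by
      intro v b c d w h1 h2 h3 h4 h5 h6 h7 h8 hvb h9 hwb
      refine h.not_isTwin hvt hc hK hvb.ne fun x => ?_
      have hvc : v ≠ c := (show G.Adj v c by simp [h9]).ne
      have hvd : v ≠ d := (show G.Adj v d by simp [h9]).ne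
      have hvw : v ≠ w := (show G.Adj v w by simp [h9]).ne
      have hx := fun hx => h.four hvb.symm h7 h8 hwb.symm hvc hvd hvw h3 h5 h6 (x := x) hx
      have := h9 x
      have := hvb.symm
      have := hwb.symm
      grind
    intro v
    obtain ⟨φ, rfl⟩ := hvt a v
    rw [← φ.map_adj_iff] at adj1 adj2 adj3 adj4 adj5 adj6
    have hbc := adj4.ne
    have hbd := adj5.ne
    have hcd := adj6.ne
    obtain ⟨w, h1, h2, h3, hw⟩ := h.three adj1 adj2 adj3 hbc hbd hcd
    refine ⟨φ b, φ c, φ d, w, hbc, hbd, hcd, h1, h2, h3, adj4, adj5, adj6, ?_, ?_, ?_, hw⟩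
    · exact twin hbc hbd hcd h1 h2 h3 adj4 adj5 adj1 hw
    · exact twin hbc.symm hcd hbd h2 h1 h3 adj4.symm adj6 adj2 (fun x => by rw [hw]; tauto)
    · exact twin hbd.symm hcd.symm hbc h3 h1 h2 adj5.symm adj6.symm adj3
        (fun x => by rw [hw]; tauto)
  have hex2 : ∀ v, ∃ w, G.Adj v w ∧ (∀ x, G.Adj v x → ¬ G.Adj w x) ∧
      (∀ x y, G.Adj v x → G.Adj v y → x ≠ w → y ≠ w → x ≠ y → G.Adj x y) := by
    intro v
    obtain ⟨b, c, d, w, h1, h2, h3, h4, h5, h6, h7, h8, h9, h10, h11, h12, hx⟩ := hex v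
    refine ⟨w, by simp [hx], ?_, ?_⟩
    · intro x hvx
      rw [hx] at hvx
      rcases hvx with rfl | rfl | rfl | rfl
      exacts [h10, h11, h12, G.irrefl]
    · intro x y hvx hvy
      rw [hx] at hvx hvy
      have := h7.symm
      have := h8.symm
      have := h9.symm
      grind
  choose m hm1 hm2 hm3 using hex2
  have hcn : ∀ {v x}, G.Adj v x → x ≠ m v → ∃ y, G.Adj v y ∧ G.Adj x y := by
    intro v x hx hne
    obtain ⟨b, c, d, w, h1, h2, h3, h4, h5, h6, h7, h8, h9, h10, h11, h12, hw⟩ := hex v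
    have := h7.symm
    have := h8.symm
    have hmv : m v = w := by
      have h13 := hm1 v
      have h14 := hm2 v b (by simp [hw])
      have h15 := hm2 v c (by simp [hw])
      rw [hw] at h13
      grind
    rw [hmv] at hne
    have hb : G.Adj v b := by simp [hw]
    have hc : G.Adj v c := by simp [hw]
    rw [hw] at hx
    rcases hx with rfl | rfl | rfl | rfl
    exacts [⟨_, hc, h7⟩, ⟨_, hb, h7.symm⟩, ⟨_, hb, h8.symm⟩, absurd rfl hne]
  have hmu : ∀ {v x}, G.Adj v x → (∀ y, G.Adj v y → ¬ G.Adj x y) → x = m v := by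
    intro v x hx hy
    by_contra hn
    obtain ⟨y, h1, h2⟩ := hcn hx hn
    exact hy y h1 h2
  have hmm : ∀ v, m (m v) = v := fun v =>
    (hmu (hm1 v).symm fun y hy hvy => hm2 v y hvy hy).symm
  have hmφ : ∀ (φ : G ≃g G) v, m (φ v) = φ (m v) := by
    intro φ v
    refine (hmu (φ.map_adj_iff.2 (hm1 v)) fun y => ?_).symm
    obtain ⟨y, rfl⟩ := φ.surjective y
    rw [φ.map_adj_iff, φ.map_adj_iff]
    exact hm2 v y
  have ssymm : ∀ {u v}, (u = v ∨ (G.Adj u v ∧ v ≠ m u)) → (v = u ∨ (G.Adj v u ∧ u ≠ m v)) := by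
    rintro u v (rfl | ⟨h1, h2⟩)
    · exact Or.inl rfl
    · exact Or.inr ⟨h1.symm, fun e => h2 (by rw [e, hmm])⟩
  let S : Setoid V := ⟨fun u v => u = v ∨ (G.Adj u v ∧ v ≠ m u), fun u => Or.inl rfl, ssymm, by
    intro u v w h1 h2
    rcases ssymm h1 with rfl | ⟨h1, h1'⟩
    · exact h2
    rcases h2 with rfl | ⟨h2, h2'⟩
    · exact ssymm (Or.inr ⟨h1, h1'⟩)
    by_cases huw : u = w
    · exact Or.inl huw
    · exact Or.inr ⟨hm3 v u w h1 h2 h1' h2' huw, fun e => hm2 u v h1.symm (e ▸ h2.symm)⟩⟩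
  have hS : ∀ u v, S u v ↔ (u = v ∨ (G.Adj u v ∧ v ≠ m u)) := fun u v => Iff.rfl
  obtain ⟨x, y, hxy, sxy, txy⟩ : ∃ x y, x ≠ y ∧ S x y ∧ S (m x) (m y) := by
    have hcl : ∀ u ∈ ({a, b, c, d} : Set V), ∀ v ∈ ({a, b, c, d} : Set V), u ≠ v → S u v := by
      intro u hu v hv huv
      refine Or.inr ⟨hs.1 hu hv huv, ?_⟩
      rintro rfl
      obtain ⟨w, hw, h1, h2⟩ : ∃ w ∈ ({a, b, c, d} : Set V), w ≠ u ∧ w ≠ m u := by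
        by_contra! hn
        have := hn a (by simp)
        have := hn b (by simp)
        have := hn c (by simp)
        grind
      exact hm2 u w (hs.1 hu hw h1.symm) (hs.1 hv hw h2.symm)
    by_contra! hn
    obtain ⟨w, hw, hD⟩ := (isStrongClique_iff.1 hs).2 (m '' {a, b, c, d}) (by
      rintro _ ⟨u, hu, rfl⟩ _ ⟨v, hv, rfl⟩ huv hadj
      have huv : u ≠ v := fun e => huv (e ▸ rfl)
      refine hn u v huv (hcl u hu v hv huv) (Or.inr ⟨hadj, ?_⟩)
      rw [hmm]
      rintro rfl
      rcases hcl _ hu v hv huv with h1 | h1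
      · exact huv h1
      · exact h1.2 (hmm v).symm)
    exact hD (m w) ⟨w, hw, rfl⟩ (hm1 w)
  refine h.nonempty_iso_graphH_of_matching hc m S hmm ?_ ?_ ?_ ?_
  · rintro v (h1 | h1)
    · exact (hm1 v).ne h1
    · exact h1.2 rfl
  · intro u v
    constructor
    · intro huv
      by_cases hv : v = m u
      · exact Or.inr hv
      · exact Or.inl ⟨Or.inr ⟨huv, hv⟩, huv.ne⟩
    · rintro (⟨h1 | h1, h2⟩ | rfl)
      exacts [absurd h1 h2, h1.1, hm1 u]
  · intro v
    obtain ⟨b, c, d, w, h1, h2, h3, h4, h5, h6, h7, h8, h9, h10, h11, h12, hw⟩ := hex v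
    have hmv : w = m v := hmu (by simp [hw]) fun y hy => by
      rw [hw] at hy
      rcases hy with rfl | rfl | rfl | rfl
      exacts [h10, h11, h12, G.irrefl]
    refine ⟨b, c, d, (show G.Adj v b by simp [hw]).ne, (show G.Adj v c by simp [hw]).ne,
      (show G.Adj v d by simp [hw]).ne, h1, h2, h3, fun x => ?_⟩
    rw [hS, hw, ← hmv]
    grind
  · intro v
    obtain ⟨φ, rfl⟩ := hvt x v
    have hSφ : ∀ u v, S (φ u) (φ v) ↔ S u v := by
      intro u v
      rw [hS, hS, hmφ, φ.map_adj_iff, φ.injective.eq_iff, φ.injective.ne_iff]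
    refine ⟨φ y, φ.injective.ne hxy, (hSφ _ _).2 sxy, ?_⟩
    rw [hmφ, hmφ]
    exact (hSφ _ _).2 txy

/-! ### Strong triangles: local structure -/

theorem IsVertexTransitive.exists_strong_triangle [Finite V] (hvt : G.IsVertexTransitive)
    {a b c : V} (hab : G.Adj a b) (hac : G.Adj a c) (hbc : G.Adj b c)
    (hs : G.IsStrongClique {a, b, c}) (v : V) :
    ∃ x y, G.Adj v x ∧ G.Adj v y ∧ G.Adj x y ∧ G.IsStrongClique {v, x, y} := by
  obtain ⟨φ, rfl⟩ := hvt a v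
  refine ⟨φ b, φ c, φ.map_adj_iff.2 hab, φ.map_adj_iff.2 hac, φ.map_adj_iff.2 hbc, ?_⟩
  simpa [Set.image_insert_eq] using hs.image φ

theorem IsStrongClique.not_common [Finite V] {a b c x : V} (hs : G.IsStrongClique {a, b, c})
    (ha : G.Adj a x) (hb : G.Adj b x) : ¬ G.Adj c x := fun hc => by
  rcases hs.triangle ha hb hc with h | h | h <;> exact G.irrefl h

/-- If the neighbourhood of `b` is the 4-cycle `p q r s` and all neighbourhoods have independence
number two, the graph is the octahedron. -/
theorem IsFourValent.nonempty_iso_lexProduct (h : G.IsFourValent) (hc : G.Connected)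
    (hl : ∀ v x y z, G.Adj v x → G.Adj v y → G.Adj v z → x ≠ y → x ≠ z → y ≠ z →
      G.Adj x y ∨ G.Adj x z) {b p q r s : V} (hp : G.Adj b p) (hq : G.Adj b q)
    (hr : G.Adj b r) (hs : G.Adj b s) (hpq : G.Adj p q) (hqr : G.Adj q r) (hrs : G.Adj r s)
    (hps : G.Adj p s) (hpr : ¬ G.Adj p r) (hqs : ¬ G.Adj q s) (npr : p ≠ r) (nqs : q ≠ s) :
    Nonempty (G ≃g (completeGraph (Fin 3)).lexProduct (⊥ : SimpleGraph (Fin 2))) := by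
  obtain ⟨o, n1, n2, n3, ho⟩ := h.three hp.symm hpq hps hq.ne hs.ne nqs
  have hpo : G.Adj p o := by simp [ho]
  have hqo : G.Adj q o := (hl p q s o hpq hps hpo nqs n2 n3).resolve_left hqs
  have hso : G.Adj s o :=
    (hl p s q o hps hpq hpo nqs.symm n3 n2).resolve_left fun h => hqs h.symm
  have hro : G.Adj r o := (hl q r p o hqr hpq.symm hqo npr.symm
    (fun e => hpr (e ▸ hpo)) hpo.ne).resolve_left fun h => hpr h.symm
  let f : Fin 3 → Fin 2 → V := ![![b, o], ![p, r], ![q, s]]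
  have h01 : ∀ j l, G.Adj (f 0 j) (f 1 l) := by
    simp only [Fin.forall_fin_two]
    exact ⟨⟨hp, hr⟩, hpo.symm, hro.symm⟩
  have h02 : ∀ j l, G.Adj (f 0 j) (f 2 l) := by
    simp only [Fin.forall_fin_two]
    exact ⟨⟨hq, hs⟩, hqo.symm, hso.symm⟩
  have h12 : ∀ j l, G.Adj (f 1 j) (f 2 l) := by
    simp only [Fin.forall_fin_two]
    exact ⟨⟨hpq, hps⟩, hqr.symm, hrs⟩
  have hf : ∀ i k, i ≠ k → ∀ j l, G.Adj (f i j) (f k l) := by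
    intro i k hik j l
    fin_cases i <;> fin_cases k
    exacts [absurd rfl hik, h01 j l, h02 j l, (h01 l j).symm, absurd rfl hik, h12 j l,
      (h02 l j).symm, (h12 l j).symm, absurd rfl hik]
  have hinj : ∀ i, f i 0 ≠ f i 1 := by
    intro i
    fin_cases i
    exacts [n1, npr, nqs]
  refine h.nonempty_iso hc (fun x => f x.1 x.2) ?_ ?_ ?_
  · rintro ⟨i, j⟩ ⟨k, l⟩ hij
    have hik : i = k := by
      by_contra hn
      exact (hf i k hn j l).ne hij
    subst hik
    fin_cases j <;> fin_cases l
    exacts [rfl, absurd hij (hinj i), absurd hij.symm (hinj i), rfl]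
  · rintro ⟨i, j⟩ ⟨k, l⟩ hij
    refine hf i k ?_ j l
    simpa [lexProduct] using hij
  · simp only [lexProduct, completeGraph, top_adj, bot_adj, and_false, or_false]
    decide

/-- In a graph with a strong triangle other than the octahedron, an edge is in at most one
triangle. -/
theorem IsStrongClique.eq_of_common [Finite V] (h : G.IsFourValent)
    (hvt : G.IsVertexTransitive) (hc : G.Connected)
    (hoct : ¬ Nonempty (G ≃g (completeGraph (Fin 3)).lexProduct (⊥ : SimpleGraph (Fin 2))))
    {a b c : V} (hab : G.Adj a b) (hac : G.Adj a c) (hbc : G.Adj b c)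
    (hs : G.IsStrongClique {a, b, c}) {u v x y : V} (huv : G.Adj u v) (hux : G.Adj u x)
    (hvx : G.Adj v x) (huy : G.Adj u y) (hvy : G.Adj v y) : x = y := by
  -- two edges of a strong triangle in further triangles: the neighbourhood of the common vertex of
  -- these edges is a 4-cycle
  have two : ∀ {a b c x y : V}, G.Adj a b → G.Adj a c → G.Adj b c → G.IsStrongClique {a, b, c} →
      G.Adj a x → G.Adj b x → G.Adj b y → G.Adj c y → x ≠ c → y ≠ a → False := by
    intro a b c x y hab hac hbc hs hax hbx hby hcy hxc hya
    have hcx : ¬ G.Adj c x := hs.not_common hax hbx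
    have hay : ¬ G.Adj a y := fun hay => hs.not_common hay hby hcy
    have hxy : G.Adj x y := by
      rcases hs.triangle hax hbx hcy with h | h | h
      exacts [absurd h G.irrefl, h, h]
    refine hoct (h.nonempty_iso_lexProduct hc ?_ hab.symm hbc hby hbx hac hcy hxy.symm hax hay hcx
      hya.symm hxc.symm)
    have hl : ∀ p q r, G.Adj b p → G.Adj b q → G.Adj b r → p ≠ q → p ≠ r → q ≠ r →
        G.Adj p q ∨ G.Adj p r := by
      have hN := fun w hw => h.four hab.symm hbc hbx hby hac.ne hax.ne hya.symm hxc.symm hcy.ne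
        hxy.ne (x := w) hw
      intro p q r hp hq hr n1 n2 n3
      have := hN p hp
      have := hN q hq
      have := hN r hr
      grind [G.adj_comm]
    intro v p q r
    obtain ⟨φ, rfl⟩ := hvt b v
    obtain ⟨p, rfl⟩ := φ.surjective p
    obtain ⟨q, rfl⟩ := φ.surjective q
    obtain ⟨r, rfl⟩ := φ.surjective r
    simp only [φ.map_adj_iff, ne_eq, φ.injective.eq_iff]
    exact hl p q r
  have perm : ∀ {a b c : V}, G.IsStrongClique {a, b, c} → G.IsStrongClique {b, a, c} :=
    fun hs => by rwa [Set.insert_comm]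
  have perm' : ∀ {a b c : V}, G.IsStrongClique {a, b, c} → G.IsStrongClique {a, c, b} :=
    fun {a b c} hs => by rwa [Set.pair_comm c b]
  have tr : ∀ {u u' x y v : V}, G.Adj u u' → G.Adj u x → G.Adj u' x → G.Adj u y → G.Adj u' y →
      x ≠ y → ∃ u' x y, G.Adj v u' ∧ G.Adj v x ∧ G.Adj u' x ∧ G.Adj v y ∧ G.Adj u' y ∧ x ≠ y := by
    intro u u' x y v h1 h2 h3 h4 h5 h6
    obtain ⟨φ, rfl⟩ := hvt u v
    exact ⟨φ u', φ x, φ y, by simpa only [φ.map_adj_iff, ne_eq, φ.injective.eq_iff] using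
      ⟨h1, h2, h3, h4, h5, h6⟩⟩
  -- exactly one edge of a strong triangle in a further triangle: the third vertex is on no edge in
  -- two triangles
  have one : ∀ {a b c x : V}, G.Adj a b → G.Adj a c → G.Adj b c → G.IsStrongClique {a, b, c} →
      G.Adj a x → G.Adj b x → x = c := by
    intro a b c x hab hac hbc hs hax hbx
    by_contra hxc
    have hbc2 : ∀ y, G.Adj b y → G.Adj c y → y = a := fun y h1 h2 => by
      by_contra hn
      exact two hab hac hbc hs hax hbx h1 h2 hxc hn
    have hac2 : ∀ y, G.Adj a y → G.Adj c y → y = b := fun y h1 h2 => by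
      by_contra hn
      exact two hab.symm hbc hac (perm hs) hbx hax h1 h2 hxc hn
    obtain ⟨u, y, z, h1, h2, h3, h4, h5, h6⟩ := tr (v := c) hab hax hbx hac hbc hxc
    obtain ⟨d, e, n1, n2, n3, n4, n5, hN⟩ := h.two hac.symm hbc.symm hab.ne
    have := (hN u).1 h1
    have := (hN y).1 h2
    have := (hN z).1 h4
    have := h3.ne
    have := h5.ne
    grind [G.adj_comm]
  by_contra hxy
  obtain ⟨u', y, z, h1, h2, h3, h4, h5, h6⟩ := tr (v := a) huv hux hvx huy hvy hxy
  have one1 := fun w => one (x := w) hab hac hbc hs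
  have one2 := fun w => one (x := w) hac hab hbc.symm (perm' hs)
  obtain ⟨d, e, n1, n2, n3, n4, n5, hN⟩ := h.two hab hac hbc.ne
  have := (hN u').1 h1
  have := (hN y).1 h2
  have := (hN z).1 h4
  have := h3.ne
  have := h5.ne
  grind [G.adj_comm]

/-! ### Every edge in a triangle: the graph `L(K_{3,3})`, isomorphic to `C₃ □ C₃` -/

/-- It suffices to find a cyclic sequence of disjoint triangles, consecutive ones being joined by a
perfect matching. -/
theorem IsFourValent.nonempty_iso_boxProd_of_layers (h : G.IsFourValent) (hc : G.Connected) {n : ℕ}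
    (hn : 3 ≤ n) (F : ZMod n → Fin 3 → V) (hadj : ∀ k i j, i ≠ j → G.Adj (F k i) (F k j))
    (hF : ∀ k l i j, F k i = F l j → k = l) (hstep : ∀ k i, G.Adj (F k i) (F (k + 1) i)) :
    Nonempty (G ≃g (cycleGraph 3).boxProd (cycleGraph n)) := by
  obtain ⟨m, rfl⟩ : ∃ m, n = m + 2 := ⟨n - 2, by omega⟩
  have h3 : ∀ i j : Fin 3, (cycleGraph 3).Adj i j ↔ i ≠ j := by decide
  refine h.nonempty_iso hc (fun q => F q.2 q.1) ?_ ?_ ?_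
  · rintro ⟨i, k⟩ ⟨j, l⟩ hkl
    obtain rfl := hF k l i j hkl
    by_contra hij
    exact (hadj k i j fun e => hij (e ▸ rfl)).ne hkl
  · rintro ⟨i, k⟩ ⟨j, l⟩ hkl
    rw [boxProd_adj, h3, cycleGraph_adj] at hkl
    dsimp only at hkl ⊢
    rcases hkl with ⟨hne, rfl⟩ | ⟨hkl, rfl⟩
    · exact hadj _ _ _ hne
    · rcases hkl with hkl | hkl
      · obtain rfl := eq_add_of_sub_eq' hkl
        exact (hstep l i).symm
      · obtain rfl := eq_add_of_sub_eq' hkl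
        exact hstep k i
  · rintro ⟨i, k⟩
    have hk : ∀ k : ZMod (m + 2), k + 1 ≠ k - 1 := by
      intro k e
      have h2 : (1 : ZMod (m + 2)) + 1 = 0 := by linear_combination e
      have h2' : ((2 : ℕ) : ZMod (m + 2)) = 0 := by
        rw [← h2]; norm_num
      rw [ZMod.natCast_eq_zero_iff] at h2'
      exact absurd (Nat.le_of_dvd (by omega) h2') (by omega)
    have hi : i ≠ i + 1 ∧ i ≠ i + 2 ∧ i + 1 ≠ i + 2 := by
      revert i
      decide
    refine ⟨(i + 1, k), (i + 2, k), (i, k + 1), (i, k - 1), ?_⟩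
    have hk' : ¬ k + 1 = k - 1 := hk k
    simp only [boxProd_adj, h3, cycleGraph_adj, ne_eq, Prod.mk.injEq]
    simp [hk', hi.1, hi.2.1, hi.2.2]

theorem ne_vec3 {a b c p q r : V} (h1 : a ≠ p) (h2 : a ≠ q) (h3 : a ≠ r) (h4 : b ≠ p)
    (h5 : b ≠ q) (h6 : b ≠ r) (h7 : c ≠ p) (h8 : c ≠ q) (h9 : c ≠ r) :
    ∀ i j, ![a, b, c] i ≠ ![p, q, r] j := by
  intro i j
  fin_cases i <;> fin_cases j <;> assumption

theorem adj_vec3 {a b c : V} (hab : G.Adj a b) (hac : G.Adj a c) (hbc : G.Adj b c) :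
    ∀ i j, i ≠ j → G.Adj (![a, b, c] i) (![a, b, c] j) := by
  intro i j hij
  fin_cases i <;> fin_cases j
  exacts [absurd rfl hij, hab, hac, hab.symm, absurd rfl hij, hbc, hac.symm, hbc.symm,
    absurd rfl hij]

/-- A graph with a strong triangle in which every edge is in exactly one triangle.  The second
triangles at the three vertices of the strong triangle are joined as in the `3 × 3` rook's graph. -/
theorem IsStrongClique.nonempty_iso_rook [Finite V] (h : G.IsFourValent)
    (hc : G.Connected) (hone : ∀ u v x y, G.Adj u v → G.Adj u x → G.Adj v x → G.Adj u y →
      G.Adj v y → x = y) (htri : ∀ u v, G.Adj u v → ∃ x, G.Adj u x ∧ G.Adj v x)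
    {a b c : V} (hab : G.Adj a b) (hac : G.Adj a c) (hbc : G.Adj b c)
    (hs : G.IsStrongClique {a, b, c}) :
    Nonempty (G ≃g (cycleGraph 3).boxProd (cycleGraph 3)) := by
  -- an outer neighbour `p` without neighbours among `q₁`, `q₂` would be adjacent to `r₁` and `r₂`
  have meet : ∀ {b c p q₁ q₂ r₁ r₂ : V}, G.Adj b q₁ → G.Adj b q₂ → G.Adj c r₁ → G.Adj c r₂ →
      G.Adj q₁ q₂ → G.Adj r₁ r₂ → c ≠ p → b ≠ r₁ → b ≠ r₂ →
      (G.Adj p q₁ ∨ G.Adj q₁ r₁ ∨ G.Adj p r₁) → (G.Adj p q₁ ∨ G.Adj q₁ r₂ ∨ G.Adj p r₂) →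
      (G.Adj p q₂ ∨ G.Adj q₂ r₁ ∨ G.Adj p r₁) → (G.Adj p q₂ ∨ G.Adj q₂ r₂ ∨ G.Adj p r₂) →
      G.Adj p q₁ ∨ G.Adj p q₂ := by
    intro b c p q₁ q₂ r₁ r₂ b1 b2 c1 c2 hq hr n1 n2 n3 s1 s2 s3 s4
    by_contra! hn
    have k : ∀ r, b ≠ r → (G.Adj p q₁ ∨ G.Adj q₁ r ∨ G.Adj p r) →
        (G.Adj p q₂ ∨ G.Adj q₂ r ∨ G.Adj p r) → G.Adj p r := by
      intro r hr h1 h2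
      rcases h1 with h1 | h1 | h1
      · exact absurd h1 hn.1
      · rcases h2 with h2 | h2 | h2
        · exact absurd h2 hn.2
        · exact absurd (hone q₁ q₂ b r hq b1.symm b2.symm h1 h2) hr
        · exact h2
      · exact h1
    exact n1 (hone r₁ r₂ c p hr c1.symm c2.symm (k r₁ n2 s1 s3).symm (k r₂ n3 s2 s4).symm)
  obtain ⟨p₁, p₂, ha1, ha2, ha3, ha4, ha5, haN⟩ := h.two hab hac hbc.ne
  obtain ⟨q₁, q₂, hb1, hb2, hb3, hb4, hb5, hbN⟩ := h.two hab.symm hbc hac.ne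
  obtain ⟨r₁, r₂, hc1, hc2, hc3, hc4, hc5, hcN⟩ := h.two hac.symm hbc.symm hab.ne
  have outer : ∀ {a b c p₁ p₂}, G.Adj a b → G.Adj a c → G.Adj b c → b ≠ p₁ → c ≠ p₁ →
      (∀ x, G.Adj a x ↔ x = b ∨ x = c ∨ x = p₁ ∨ x = p₂) → G.Adj p₁ p₂ := by
    intro a b c p₁ p₂ hab hac hbc n1 n2 hN
    have hp : G.Adj a p₁ := by simp [hN]
    obtain ⟨x, hx1, hx2⟩ := htri a p₁ hp
    have h1 := hone a b c p₁ hab hac hbc hp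
    have h2 := hone a c b p₁ hac hab hbc.symm hp
    rcases (hN x).1 hx1 with rfl | rfl | rfl | rfl
    exacts [absurd (h1 hx2.symm) n2, absurd (h2 hx2.symm) n1, absurd hx2 G.irrefl, hx2]
  have ap1 : G.Adj a p₁ := by simp [haN]
  have ap2 : G.Adj a p₂ := by simp [haN]
  have bq1 : G.Adj b q₁ := by simp [hbN]
  have bq2 : G.Adj b q₂ := by simp [hbN]
  have cr1 : G.Adj c r₁ := by simp [hcN]
  have cr2 : G.Adj c r₂ := by simp [hcN]
  have hp := outer hab hac hbc ha1 ha2 haN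
  have hq := outer hab.symm hbc hac hb1 hb2 hbN
  have hr := outer hac.symm hbc.symm hab hc1 hc2 hcN
  have key : ∀ p₁ p₂ q₁ q₂ r₁ r₂, G.Adj a p₁ → G.Adj a p₂ → G.Adj b q₁ → G.Adj b q₂ →
      G.Adj c r₁ → G.Adj c r₂ → G.Adj p₁ p₂ → G.Adj q₁ q₂ → G.Adj r₁ r₂ →
      p₁ ∉ ({b, c} : Set V) → p₂ ∉ ({b, c} : Set V) → q₁ ∉ ({a, c} : Set V) →
      q₂ ∉ ({a, c} : Set V) → r₁ ∉ ({a, b} : Set V) → r₂ ∉ ({a, b} : Set V) →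
      G.Adj p₁ q₁ → G.Adj p₁ r₁ → Nonempty (G ≃g (cycleGraph 3).boxProd (cycleGraph 3)) := by
    intro p₁ p₂ q₁ q₂ r₁ r₂ ap1 ap2 bq1 bq2 cr1 cr2 hp hq hr hp1 hp2 hq1 hq2 hr1 hr2 hpq hpr
    simp only [Set.mem_insert_iff, Set.mem_singleton_iff, not_or] at hp1 hp2 hq1 hq2 hr1 hr2
    have nb : ∀ x, G.Adj a x → G.Adj b x → x = c := fun x h1 h2 => hone a b x c hab h1 h2 hac hbc
    have nc : ∀ x, G.Adj a x → G.Adj c x → x = b :=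
      fun x h1 h2 => hone a c x b hac h1 h2 hab hbc.symm
    have na : ∀ x, G.Adj b x → G.Adj c x → x = a :=
      fun x h1 h2 => hone b c x a hbc h1 h2 hab.symm hac.symm
    have P : ∀ x, x ≠ a → ¬ (G.Adj p₁ x ∧ G.Adj p₂ x) := fun x hx h1 =>
      hx (hone p₁ p₂ x a hp h1.1 h1.2 ap1.symm ap2.symm)
    have Q : ∀ x, x ≠ b → ¬ (G.Adj q₁ x ∧ G.Adj q₂ x) := fun x hx h1 =>
      hx (hone q₁ q₂ x b hq h1.1 h1.2 bq1.symm bq2.symm)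
    have R : ∀ x, x ≠ c → ¬ (G.Adj r₁ x ∧ G.Adj r₂ x) := fun x hx h1 =>
      hx (hone r₁ r₂ x c hr h1.1 h1.2 cr1.symm cr2.symm)
    have s122 := hs.triangle ap1 bq2 cr2
    have s212 := hs.triangle ap2 bq1 cr2
    have s221 := hs.triangle ap2 bq2 cr1
    have s211 := hs.triangle ap2 bq1 cr1
    have Pq1 := P q₁ hq1.1
    have Pr1 := P r₁ hr1.1
    have Qp1 := Q p₁ hp1.1
    have Rp1 := R p₁ hp1.2
    have q2r2 : G.Adj q₂ r₂ := by
      rcases s122 with h1 | h1 | h1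
      · exact absurd ⟨hpq.symm, h1.symm⟩ Qp1
      · exact h1
      · exact absurd ⟨hpr.symm, h1.symm⟩ Rp1
    have p2r2 : G.Adj p₂ r₂ := by
      rcases s212 with h1 | h1 | h1
      · exact absurd ⟨hpq, h1⟩ Pq1
      · exact absurd ⟨h1, q2r2⟩ (Q r₂ hr2.2)
      · exact h1
    have p2q2 : G.Adj p₂ q₂ := by
      rcases s221 with h1 | h1 | h1
      · exact h1
      · exact absurd ⟨h1.symm, q2r2.symm⟩ (R q₂ hq2.2)
      · exact absurd ⟨hpr, h1⟩ Pr1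
    have q1r1 : G.Adj q₁ r₁ := by
      rcases s211 with h1 | h1 | h1
      · exact absurd ⟨hpq, h1⟩ Pq1
      · exact h1
      · exact absurd ⟨hpr, h1⟩ Pr1
    let F : Fin 3 → Fin 3 → V := ![![a, b, c], ![p₁, q₁, r₁], ![p₂, q₂, r₂]]
    have D01 : ∀ i j, F 0 i ≠ F 1 j := ne_vec3 ap1.ne (Ne.symm hq1.1) (Ne.symm hr1.1)
      (Ne.symm hp1.1) bq1.ne (Ne.symm hr1.2) (Ne.symm hp1.2) (Ne.symm hq1.2) cr1.ne
    have D02 : ∀ i j, F 0 i ≠ F 2 j := ne_vec3 ap2.ne (Ne.symm hq2.1) (Ne.symm hr2.1)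
      (Ne.symm hp2.1) bq2.ne (Ne.symm hr2.2) (Ne.symm hp2.2) (Ne.symm hq2.2) cr2.ne
    have D12 : ∀ i j, F 1 i ≠ F 2 j := ne_vec3 hp.ne
      (fun e => hp1.2 (nb p₁ ap1 (e ▸ bq2))) (fun e => hp1.1 (nc p₁ ap1 (e ▸ cr2)))
      (fun e => hp2.2 (nb p₂ ap2 (e ▸ bq1))) hq.ne (fun e => hq1.1 (na q₁ bq1 (e ▸ cr2)))
      (fun e => hp2.1 (nc p₂ ap2 (e ▸ cr1))) (fun e => hq2.1 (na q₂ bq2 (e ▸ cr1))) hr.ne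
    refine h.nonempty_iso_boxProd_of_layers hc le_rfl F ?_ ?_ ?_
    · intro k
      change Fin 3 at k
      fin_cases k
      exacts [adj_vec3 hab hac hbc, adj_vec3 hpq hpr q1r1, adj_vec3 p2q2 p2r2 q2r2]
    · intro k l i j hkl
      change Fin 3 at k l
      fin_cases k <;> fin_cases l
      exacts [rfl, absurd hkl (D01 i j), absurd hkl (D02 i j), absurd hkl.symm (D01 j i), rfl,
        absurd hkl (D12 i j), absurd hkl.symm (D02 j i), absurd hkl.symm (D12 j i), rfl]
    · intro k i
      change Fin 3 at k
      fin_cases k <;> fin_cases i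
      exacts [ap1, bq1, cr1, hp, hq, hr, ap2.symm, bq2.symm, cr2.symm]
  have hPq : G.Adj p₁ q₁ ∨ G.Adj p₁ q₂ := meet bq1 bq2 cr1 cr2 hq hr ha2 hc2 hc4
    (hs.triangle ap1 bq1 cr1) (hs.triangle ap1 bq1 cr2) (hs.triangle ap1 bq2 cr1)
    (hs.triangle ap1 bq2 cr2)
  have hs' : G.IsStrongClique {a, c, b} := by rwa [Set.pair_comm c b]
  have hPr : G.Adj p₁ r₁ ∨ G.Adj p₁ r₂ := meet cr1 cr2 bq1 bq2 hr hq ha1 hb2 hb4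
    (hs'.triangle ap1 cr1 bq1) (hs'.triangle ap1 cr1 bq2) (hs'.triangle ap1 cr2 bq1)
    (hs'.triangle ap1 cr2 bq2)
  have m1 : p₁ ∉ ({b, c} : Set V) := by simp [ha1.symm, ha2.symm]
  have m2 : p₂ ∉ ({b, c} : Set V) := by simp [ha3.symm, ha4.symm]
  have m3 : q₁ ∉ ({a, c} : Set V) := by simp [hb1.symm, hb2.symm]
  have m4 : q₂ ∉ ({a, c} : Set V) := by simp [hb3.symm, hb4.symm]
  have m5 : r₁ ∉ ({a, b} : Set V) := by simp [hc1.symm, hc2.symm]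
  have m6 : r₂ ∉ ({a, b} : Set V) := by simp [hc3.symm, hc4.symm]
  rcases hPq with h1 | h1 <;> rcases hPr with h2 | h2
  · exact key p₁ p₂ q₁ q₂ r₁ r₂ ap1 ap2 bq1 bq2 cr1 cr2 hp hq hr m1 m2 m3 m4 m5 m6 h1 h2
  · exact key p₁ p₂ q₁ q₂ r₂ r₁ ap1 ap2 bq1 bq2 cr2 cr1 hp hq hr.symm m1 m2 m3 m4 m6 m5 h1 h2
  · exact key p₁ p₂ q₂ q₁ r₁ r₂ ap1 ap2 bq2 bq1 cr1 cr2 hp hq.symm hr m1 m2 m4 m3 m5 m6 h1 h2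
  · exact key p₁ p₂ q₂ q₁ r₂ r₁ ap1 ap2 bq2 bq1 cr2 cr1 hp hq.symm hr.symm m1 m2 m4 m3 m6 m5 h1 h2

/-! ### Every vertex in a unique triangle: how the triangles are linked -/

/-- The structure of a 4-valent vertex-transitive graph in which every vertex is in exactly one
triangle, and all these triangles are strong.  The classes of `S` are the triangles, and
`O` is adjacency between different triangles. -/
structure IsTriangleSystem (S : Setoid V) (O : V → V → Prop) : Prop where
  symm : ∀ {u v}, O u v → O v u
  class_eq : ∀ v, ∃ b c, v ≠ b ∧ v ≠ c ∧ b ≠ c ∧ ∀ x, S v x ↔ x = v ∨ x = b ∨ x = c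
  not_rel : ∀ {u v}, O u v → ¬ S u v
  outer : ∀ v, ∃ p q, p ≠ q ∧ ∀ x, O v x ↔ x = p ∨ x = q
  inj : ∀ {u v w}, O u v → O u w → S v w → v = w
  strong : ∀ {a b c p q r}, a ≠ b → a ≠ c → b ≠ c → S a b → S a c → O a p → O b q → O c r →
    (S p q ∨ O p q) ∨ (S q r ∨ O q r) ∨ (S p r ∨ O p r)
  trans : ∀ u v, ∃ φ : V ≃ V, φ u = v ∧ (∀ x y, S (φ x) (φ y) ↔ S x y) ∧
    ∀ x y, O (φ x) (φ y) ↔ O x y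

/-- The vertex `w` has an outer neighbour in the triangle of `u`. -/
def IsLinked (S : Setoid V) (O : V → V → Prop) (w u : V) : Prop :=
  ∃ x, S u x ∧ O w x

namespace IsTriangleSystem

variable {S : Setoid V} {O : V → V → Prop}

theorem isLinked_map {φ : V ≃ V} (hS : ∀ x y, S (φ x) (φ y) ↔ S x y)
    (hO : ∀ x y, O (φ x) (φ y) ↔ O x y) (w u : V) :
    IsLinked S O (φ w) (φ u) ↔ IsLinked S O w u := by
  constructor
  · rintro ⟨x, h1, h2⟩
    obtain ⟨x, rfl⟩ := φ.surjective x
    exact ⟨x, (hS _ _).1 h1, (hO _ _).1 h2⟩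
  · rintro ⟨x, h1, h2⟩
    exact ⟨φ x, (hS _ _).2 h1, (hO _ _).2 h2⟩

theorem mates (h : IsTriangleSystem S O) {a b c x : V} (hab : a ≠ b) (hac : a ≠ c) (hbc : b ≠ c)
    (sb : S a b) (sc : S a c) (sx : S a x) : x = a ∨ x = b ∨ x = c := by
  obtain ⟨b', c', h1, h2, h3, h4⟩ := h.class_eq a
  rw [h4] at sb sc sx
  grind

theorem third (h : IsTriangleSystem S O) {a b : V} (hab : a ≠ b) (sb : S a b) :
    ∃ c, a ≠ c ∧ b ≠ c ∧ S a c := by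
  obtain ⟨b', c', h1, h2, h3, h4⟩ := h.class_eq a
  have k := (h4 b).1 sb
  rcases k with k | k | k
  · exact absurd k.symm hab
  · exact ⟨c', h2, k ▸ h3, (h4 _).2 (by simp)⟩
  · exact ⟨b', h1, k ▸ h3.symm, (h4 _).2 (by simp)⟩

theorem other (h : IsTriangleSystem S O) {v p : V} (hp : O v p) : ∃ q, p ≠ q ∧ O v q := by
  obtain ⟨p', q', h1, h2⟩ := h.outer v
  rcases (h2 p).1 hp with rfl | rfl
  · exact ⟨q', h1, (h2 _).2 (by simp)⟩
  · exact ⟨p', h1.symm, (h2 _).2 (by simp)⟩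

theorem two (h : IsTriangleSystem S O) {v p q x : V} (hp : O v p) (hq : O v q) (hpq : p ≠ q)
    (hx : O v x) : x = p ∨ x = q := by
  obtain ⟨p', q', h1, h2⟩ := h.outer v
  rw [h2] at hp hq hx
  grind

theorem inj_right (h : IsTriangleSystem S O) {u v p : V} (hu : O u p) (hv : O v p) (s : S u v) :
    u = v :=
  h.inj (h.symm hu) (h.symm hv) s

/-- If triangles are doubly linked to other triangles, every two vertices of a triangle have
their outer neighbours in precisely one common triangle, and no triangle is linked to all three
vertices. -/
theorem double_links (h : IsTriangleSystem S O) {v u w w' : V} (hvu : O v u) (hvw : v ≠ w)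
    (hvw' : v ≠ w') (hww' : w ≠ w') (sw : S v w) (sw' : S v w') (hw : IsLinked S O w u)
    (hw' : ¬ IsLinked S O w' u) (a b c : V) (hab : a ≠ b) (hac : a ≠ c) (hbc : b ≠ c)
    (sb : S a b) (sc : S a c) :
    ∃ a₁ a₂ b₁ b₂ c₁ c₂, O a a₁ ∧ O a a₂ ∧ O b b₁ ∧ O b b₂ ∧ O c c₁ ∧ O c c₂ ∧
      S a₁ b₁ ∧ S b₂ c₁ ∧ S c₂ a₂ ∧ ¬ S a₁ b₂ ∧ ¬ S b₂ c₂ ∧ ¬ S a₁ c₂ := by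
  have sy : ∀ {u v}, S u v → S v u := fun h => S.symm h
  have tr : ∀ {u v w}, S u v → S v w → S u w := fun h h' => S.trans h h'
  -- `D v u`: the edge from `v` to `u` is one of exactly two edges between the two triangles
  let D : V → V → Prop := fun v u => O v u ∧ ∃ w w', v ≠ w ∧ v ≠ w' ∧ w ≠ w' ∧ S v w ∧ S v w' ∧
    IsLinked S O w u ∧ ¬ IsLinked S O w' u
  have Dmap : ∀ (φ : V ≃ V), (∀ x y, S (φ x) (φ y) ↔ S x y) → (∀ x y, O (φ x) (φ y) ↔ O x y) →
      ∀ v u, D v u → D (φ v) (φ u) := by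
    rintro φ hS hO v u ⟨h1, w, w', h2, h3, h4, h5, h6, h7, h8⟩
    refine ⟨(hO _ _).2 h1, φ w, φ w', φ.injective.ne h2, φ.injective.ne h3, φ.injective.ne h4,
      (hS _ _).2 h5, (hS _ _).2 h6, (isLinked_map hS hO _ _).2 h7, fun h9 => ?_⟩
    exact h8 ((isLinked_map hS hO _ _).1 h9)
  have D1 : ∀ v, ∃ u, D v u := by
    intro x
    obtain ⟨φ, rfl, hS, hO⟩ := h.trans v x
    exact ⟨φ u, Dmap φ hS hO v u ⟨hvu, w, w', hvw, hvw', hww', sw, sw', hw, hw'⟩⟩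
  -- the third vertex of the triangle of `v` has a double link, too, and so its partner in this
  -- double link has two double links
  have D2 : ∃ v, ∀ u, O v u → D v u := by
    obtain ⟨x, hx1, hx2⟩ := hw
    have Dv : D v u := ⟨hvu, w, w', hvw, hvw', hww', sw, sw', ⟨x, hx1, hx2⟩, hw'⟩
    have Dw : D w x := ⟨hx2, v, w', hvw.symm, hww', hvw', sy sw, tr (sy sw) sw', ⟨u, sy hx1, hvu⟩,
      fun ⟨y, hy, hy'⟩ => hw' ⟨y, tr hx1 hy, hy'⟩⟩
    obtain ⟨y, hy, z, z', n1, n2, n3, s1, s2, ⟨t, ht, hzt⟩, hz'⟩ := D1 w'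
    have Dz : D z t := ⟨hzt, w', z', n1.symm, n3, n2, sy s1, tr (sy s1) s2, ⟨y, sy ht, hy⟩,
      fun ⟨y', hy1, hy'⟩ => hz' ⟨y', tr ht hy1, hy'⟩⟩
    have hz : z = v ∨ z = w := by
      rcases h.mates hvw hvw' hww' sw sw' (tr sw' s1) with rfl | rfl | rfl
      exacts [Or.inl rfl, Or.inr rfl, absurd rfl n1]
    rcases hz with rfl | rfl
    · have htu : u ≠ t := by
        rintro rfl
        exact hw' ⟨y, sy ht, hy⟩
      refine ⟨z, fun u' hu' => ?_⟩
      rcases h.two hvu hzt htu hu' with rfl | rfl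
      exacts [Dv, Dz]
    · have htu : x ≠ t := by
        rintro rfl
        exact hw' ⟨y, tr hx1 (sy ht), hy⟩
      refine ⟨z, fun u' hu' => ?_⟩
      rcases h.two hx2 hzt htu hu' with rfl | rfl
      exacts [Dw, Dz]
  have D3 : ∀ v u, O v u → D v u := by
    obtain ⟨v₀, hv₀⟩ := D2
    intro v u hvu
    obtain ⟨φ, rfl, hS, hO⟩ := h.trans v₀ v
    obtain ⟨u, rfl⟩ := φ.surjective u
    exact Dmap φ hS hO _ _ (hv₀ u ((hO _ _).1 hvu))
  have link : ∀ {a b c a₁}, a ≠ b → a ≠ c → b ≠ c → S a b → S a c → O a a₁ →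
      (IsLinked S O b a₁ ∧ ¬ IsLinked S O c a₁) ∨ (IsLinked S O c a₁ ∧ ¬ IsLinked S O b a₁) := by
    intro a b c a₁ hab hac hbc sb sc ha
    obtain ⟨-, w, w', n1, n2, n3, s1, s2, h1, h2⟩ := D3 _ _ ha
    rcases h.mates hab hac hbc sb sc s1 with rfl | rfl | rfl <;>
      rcases h.mates hab hac hbc sb sc s2 with rfl | rfl | rfl <;> first
      | exact absurd rfl n1 | exact absurd rfl n2 | exact absurd rfl n3
      | exact Or.inl ⟨h1, h2⟩ | exact Or.inr ⟨h1, h2⟩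
  obtain ⟨p, q, hpq, hO⟩ := h.outer a
  have hp : O a p := (hO p).2 (by simp)
  have hq : O a q := (hO q).2 (by simp)
  have hnpq : ¬ S p q := fun s => hpq (h.inj hp hq s)
  -- the second double link at `b` is shared with `c`
  have rest : ∀ {b c}, a ≠ b → a ≠ c → b ≠ c → S a b → S a c → IsLinked S O b p →
      ¬ IsLinked S O c p → ¬ IsLinked S O b q → ∃ b₁ b₂ c₁, O b b₁ ∧ O b b₂ ∧ O c c₁ ∧
      S p b₁ ∧ S b₂ c₁ ∧ ¬ S b₂ p ∧ ¬ S b₂ q := by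
    rintro b c hab hac hbc sb sc ⟨b₁, h1, h2⟩ h3 h4
    obtain ⟨b₂, h5, h6⟩ := h.other h2
    have n1 : ¬ S b₂ p := fun s => h5 (h.inj h2 h6 (tr (sy h1) (sy s)))
    have n2 : ¬ S b₂ q := fun s => h4 ⟨b₂, sy s, h6⟩
    rcases link hab.symm hbc hac (sy sb) (tr (sy sb) sc) h6 with
      ⟨⟨y, hy1, hy2⟩, -⟩ | ⟨⟨y, hy1, hy2⟩, -⟩
    · rcases h.two hp hq hpq hy2 with rfl | rfl
      exacts [absurd hy1 n1, absurd hy1 n2]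
    · exact ⟨b₁, b₂, y, h2, h6, hy2, h1, hy1, n1, n2⟩
  have both : ∀ {b c}, a ≠ b → a ≠ c → b ≠ c → S a b → S a c → IsLinked S O b p →
      ¬ IsLinked S O c p → IsLinked S O b q → ¬ IsLinked S O c q → False := by
    rintro b c hab hac hbc sb sc ⟨b₁, h1, h2⟩ h3 ⟨b₂, h4, h5⟩ h6
    obtain ⟨c₁, hc1⟩ : ∃ c₁, O c c₁ := ⟨_, (D1 c).choose_spec.1⟩
    rcases link hac.symm hbc.symm hab (sy sc) (tr (sy sc) sb) hc1 with
      ⟨⟨y, hy1, hy2⟩, -⟩ | ⟨⟨y, hy1, hy2⟩, -⟩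
    · rcases h.two hp hq hpq hy2 with rfl | rfl
      exacts [h3 ⟨c₁, sy hy1, hc1⟩, h6 ⟨c₁, sy hy1, hc1⟩]
    · rcases h.two h2 h5 (fun e => hnpq (tr h1 (sy (e ▸ h4)))) hy2 with rfl | rfl
      exacts [h3 ⟨c₁, tr h1 (sy hy1), hc1⟩, h6 ⟨c₁, tr h4 (sy hy1), hc1⟩]
  rcases link hab hac hbc sb sc hp with ⟨h1, h2⟩ | ⟨h1, h2⟩ <;>
    rcases link hab hac hbc sb sc hq with ⟨h3, h4⟩ | ⟨h3, h4⟩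
  · exact absurd (both hab hac hbc sb sc h1 h2 h3 h4) id
  · obtain ⟨b₁, b₂, c₁, k1, k2, k3, k4, k5, k6, k7⟩ := rest hab hac hbc sb sc h1 h2 h4
    obtain ⟨c₂, k8, k9⟩ := h3
    exact ⟨p, q, b₁, b₂, c₁, c₂, hp, hq, k1, k2, k3, k9, k4, k5, sy k8, fun s => k6 (sy s),
      fun s => k7 (tr s (sy k8)), fun s => hnpq (tr s (sy k8))⟩
  · obtain ⟨b₁, k1, k2⟩ := h3
    obtain ⟨c₁, c₂, y, k3, k4, k5, k6, k7, k8, k9⟩ :=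
      rest hac hab hbc.symm sc sb h1 h2 h4
    refine ⟨q, p, b₁, y, c₂, c₁, hq, hp, k2, k5, k4, k3, k1, sy k7, sy k6, fun s => ?_, fun s => ?_,
      fun s => ?_⟩
    · exact k9 (tr k7 (sy s))
    · exact k8 (tr k7 (tr s (sy k6)))
    · exact hnpq (tr k6 (sy s))
  · exact absurd (both hac hab hbc.symm sc sb h1 h2 h3 h4) id

/-- No two triangles are linked by exactly two edges. -/
theorem not_double_link (h : IsTriangleSystem S O) {v u w w' : V} (hvu : O v u) (hvw : v ≠ w)
    (hvw' : v ≠ w') (hww' : w ≠ w') (sw : S v w) (sw' : S v w') (hw : IsLinked S O w u) :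
    IsLinked S O w' u := by
  by_contra hw'
  have hd := h.double_links hvu hvw hvw' hww' sw sw' hw hw'
  have rf : ∀ {u}, S u u := fun {u} => S.refl u
  have sy : ∀ {u v}, S u v → S v u := fun h => S.symm h
  have tr : ∀ {u v w}, S u v → S v w → S u w := fun h h' => S.trans h h'
  have hM : ∀ {u w p p' q q'}, u ≠ w → S u w → O u p → O w p' → S p p' → O u q → O w q' →
      S q q' → p = q := by
    intro u w p p' q q' huw suw hp hp' hpp hq hq' hqq
    obtain ⟨x, hux, hwx, sux⟩ := h.third huw suw
    obtain ⟨a₁, a₂, b₁, b₂, c₁, c₂, oa1, oa2, ob1, ob2, oc1, oc2, s1, s2, s3, n1, n2, n3⟩ :=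
      hd u w x huw hux hwx suw sux
    have na : a₁ ≠ a₂ := fun e => n3 (e ▸ sy s3)
    have nb : b₁ ≠ b₂ := fun e => n1 (e ▸ s1)
    have key : ∀ {p p'}, O u p → O w p' → S p p' → p = a₁ := by
      intro p p' hp hp' hpp
      rcases h.two oa1 oa2 na hp with rfl | rfl
      · rfl
      · rcases h.two ob1 ob2 nb hp' with rfl | rfl
        · exact absurd (tr s1 (tr (sy hpp) (sy s3))) n3
        · exact absurd (sy (tr s3 hpp)) n2
    rw [key hp hp' hpp, key hq hq' hqq]
  have hN : ∀ {u w}, u ≠ w → S u w → ∃ p p', O u p ∧ O w p' ∧ S p p' := by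
    intro u w huw suw
    obtain ⟨x, hux, hwx, sux⟩ := h.third huw suw
    obtain ⟨a₁, a₂, b₁, b₂, c₁, c₂, oa1, oa2, ob1, ob2, oc1, oc2, s1, s2, s3, n1, n2, n3⟩ :=
      hd u w x huw hux hwx suw sux
    exact ⟨a₁, b₁, oa1, ob1, s1⟩
  have hQ : ∀ {u w x p q r}, u ≠ w → u ≠ x → w ≠ x → S u w → S u x → O u p → O w q → O x r →
      S p q → S p r → False := by
    intro u w x p q r huw hux hwx suw sux op oq or spq spr
    obtain ⟨a₁, a₂, b₁, b₂, c₁, c₂, oa1, oa2, ob1, ob2, oc1, oc2, s1, s2, s3, n1, n2, n3⟩ :=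
      hd u w x huw hux hwx suw sux
    have nc : c₁ ≠ c₂ := fun e => n2 (e ▸ s2)
    obtain rfl := hM huw suw op oq spq oa1 ob1 s1
    rcases h.two oc1 oc2 nc or with rfl | rfl
    exacts [n1 (tr spr (sy s2)), n3 spr]
  -- `a₁` and `b₂` are not adjacent: strength would force another edge `a₂ b₁` or `c₁ a₂`.  With the
  -- former there is an outer path of length three from `a` to a mate of `a` in its triangle, but no
  -- such path from `c`; with the latter the triangle of `b₂` and `c₁` is not strong.
  have core : ∀ {a b c a₁ a₂ b₁ b₂ c₁ c₂}, a ≠ b → a ≠ c → b ≠ c → S a b → S a c → O a a₁ →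
      O a a₂ → O b b₁ → O b b₂ → O c c₁ → O c c₂ → S a₁ b₁ → S b₂ c₁ → S c₂ a₂ → ¬ S a₁ b₂ →
      ¬ S b₂ c₂ → ¬ S a₁ c₂ → O a₁ b₂ → False := by
    intro a b c a₁ a₂ b₁ b₂ c₁ c₂ hab hac hbc sab sac oa1 oa2 ob1 ob2 oc1 oc2 s1 s2 s3 n1 n2 n3
      hab12
    have na : a₁ ≠ a₂ := fun e => n3 (e ▸ sy s3)
    have nb : b₁ ≠ b₂ := fun e => n1 (e ▸ s1)
    have nc : c₁ ≠ c₂ := fun e => n2 (e ▸ s2)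
    have sbc : S b c := tr (sy sab) sac
    have nab : a₁ ≠ b₁ := fun e => hab (h.inj_right oa1 (e ▸ ob1) sab)
    -- outer neighbours of the triangle are not in the triangle
    have out : ∀ {x y z}, S a x → O x y → S a z → ¬ S y z := fun hx hy hz hyz =>
      h.not_rel hy (tr (sy hx) (tr hz (sy hyz)))
    have da1 : ∀ {y}, O a₁ y → y = a ∨ y = b₂ := fun hy =>
      h.two (h.symm oa1) hab12 (fun e => out sab ob2 rf (e ▸ rf)) hy
    have db2 : ∀ {y}, O b₂ y → y = b ∨ y = a₁ := fun hy =>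
      h.two (h.symm ob2) (h.symm hab12) (fun e => out rf oa1 sab (e ▸ rf)) hy
    have hopp : O a₂ b₁ ∨ O c₁ a₂ := by
      have nt : ∀ {x y}, S a₁ x → S b₂ y → ¬ S x y := fun h1 h2 h3 => n1 (tr h1 (tr h3 (sy h2)))
      rcases h.strong hab hac hbc sab sac oa2 ob1 oc1 with (h1 | h1) | (h1 | h1) | (h1 | h1)
      · exact absurd (tr s1 (tr (sy h1) (sy s3))) n3
      · exact Or.inl h1
      · exact absurd h1 (nt s1 s2)
      · have := hM nab s1 (h.symm oa1) (h.symm ob1) sab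
          hab12 h1 s2
        exact absurd rf (this ▸ out sab ob2 rf)
      · exact absurd (sy (tr s3 (tr h1 (sy s2)))) n2
      · exact Or.inr (h.symm h1)
    rcases hopp with hop | hop
    · -- the outer path `a, a₁, b₂, b` is copied to `c`
      obtain ⟨φ, hφ, hS, hO⟩ := h.trans a c
      have p1 := (hO _ _).2 oa1
      have p2 := (hO _ _).2 hab12
      have p3 := (hO _ _).2 (h.symm ob2)
      have p4 := (hS _ _).2 sab
      have p5 := φ.injective.ne hab
      rw [hφ] at p1 p4 p5
      have da2 : ∀ {y}, O a₂ y → y = a ∨ y = b₁ := fun hy =>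
        h.two (h.symm oa2) hop (fun e => out sab ob1 rf (e ▸ rf)) hy
      have db1 : ∀ {y}, O b₁ y → y = b ∨ y = a₂ := fun hy =>
        h.two (h.symm ob1) (h.symm hop) (fun e => out rf oa2 sab (e ▸ rf)) hy
      generalize φ a₁ = x at *
      generalize φ b₂ = y at *
      generalize φ b = z at *
      -- no outer neighbour of `c` is an outer neighbour of `a` or `b`, or in the triangle
      have hx : x ≠ a ∧ x ≠ b ∧ x ≠ a₁ ∧ x ≠ a₂ ∧ x ≠ b₁ ∧ x ≠ b₂ := by
        refine ⟨?_, ?_, ?_, ?_, ?_, ?_⟩ <;> rintro rfl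
        · exact out sac p1 rf rf
        · exact out sac p1 sab rf
        · exact hac (h.inj_right oa1 p1 sac)
        · exact hac (h.inj_right oa2 p1 sac)
        · exact hbc (h.inj_right ob1 p1 sbc)
        · exact hbc (h.inj_right ob2 p1 sbc)
      have hz : z = a ∨ z = b := by
        rcases h.mates hab hac hbc sab sac (tr sac p4) with rfl | rfl | rfl
        exacts [Or.inl rfl, Or.inr rfl, absurd rfl p5]
      have hy : y = a₁ ∨ y = a₂ ∨ y = b₁ ∨ y = b₂ := by
        rcases hz with rfl | rfl
        · rcases h.two oa1 oa2 na (h.symm p3) with rfl | rfl <;> simp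
        · rcases h.two ob1 ob2 nb (h.symm p3) with rfl | rfl <;> simp
      have p2' := h.symm p2
      rcases hy with rfl | rfl | rfl | rfl
      · rcases da1 p2' with e | e <;> simp [e] at hx
      · rcases da2 p2' with e | e <;> simp [e] at hx
      · rcases db1 p2' with e | e <;> simp [e] at hx
      · rcases db2 p2' with e | e <;> simp [e] at hx
    · -- the triangle of `b₂` and `c₁` has the independent outer transversal `b`, `a₂`, `x₁`
      have nbc : b₂ ≠ c₁ := fun e => hbc (h.inj_right ob2 (e ▸ oc1) sbc)
      obtain ⟨x, hbx, hcx, sx⟩ := h.third nbc s2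
      have da2 : ∀ {y}, O a₂ y → y = a ∨ y = c₁ := fun hy =>
        h.two (h.symm oa2) (h.symm hop) (fun e => out sac oc1 rf (e ▸ rf)) hy
      obtain ⟨x₁, y, ox1, oy, sxy⟩ := hN hbx.symm (sy sx)
      rcases db2 oy with rfl | rfl
      · exact hQ nbc hbx hcx s2 sx (h.symm ob2) (h.symm oc1) ox1 sbc (sy sxy)
      rcases h.strong nbc hbx hcx s2 sx (h.symm ob2) hop ox1 with
        (h1 | h1) | (h1 | h1) | (h1 | h1)
      · exact out rf oa2 sab (sy h1)
      · rcases h.two ob1 ob2 nb h1 with rfl | rfl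
        · exact n3 (tr s1 (sy s3))
        · exact n2 (sy s3)
      · exact n3 (sy (tr s3 (tr h1 sxy)))
      · rcases da2 h1 with rfl | rfl
        · exact out rf oa1 rf (sy sxy)
        · exact n1 (sy (tr s2 sxy))
      · exact out rf oa1 sab (sy (tr h1 sxy))
      · rcases h.two ob1 ob2 nb h1 with rfl | rfl
        · have := hM nab s1 (h.symm oa1) (h.symm ob1)
            sab hab12 (h.symm ox1) sx
          exact out sab ob2 rf (this ▸ rf)
        · exact n1 (sy sxy)
  obtain ⟨a₁, a₂, b₁, b₂, c₁, c₂, oa1, oa2, ob1, ob2, oc1, oc2, s1, s2, s3, n1, n2, n3⟩ :=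
    hd v w w' hvw hvw' hww' sw sw'
  have sww' : S w w' := tr (sy sw) sw'
  rcases h.strong hvw hvw' hww' sw sw' oa1 ob2 oc2 with (h1 | h1) | (h1 | h1) | (h1 | h1)
  · exact n1 h1
  · exact core hvw hvw' hww' sw sw' oa1 oa2 ob1 ob2 oc1 oc2 s1 s2 s3 n1 n2 n3 h1
  · exact n2 h1
  · exact core hww' hvw.symm hvw'.symm sww' (sy sw) ob2 ob1 oc1 oc2 oa2 oa1 s2 s3 s1 n2
      (fun s => n3 (sy s)) (fun s => n1 (sy s)) h1
  · exact n3 h1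
  · exact core hvw'.symm hww'.symm hvw (sy sw') (sy sww') oc2 oc1 oa2 oa1 ob1 ob2 s3 s1 s2
      (fun s => n3 (sy s)) n1 (fun s => n2 (sy s)) (h.symm h1)

/-- No edge is the only one between two triangles. -/
theorem not_single_link (h : IsTriangleSystem S O) {v u : V} (hvu : O v u)
    (hn : ∀ w, v ≠ w → S v w → ¬ IsLinked S O w u) : False := by
  have rf : ∀ {u}, S u u := fun {u} => S.refl u
  have sy : ∀ {u v}, S u v → S v u := fun h => S.symm h
  have tr : ∀ {u v w}, S u v → S v w → S u w := fun h h' => S.trans h h'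
  have hE : ∀ v, ∃ u, O v u ∧ ∀ w, v ≠ w → S v w → ¬ IsLinked S O w u := by
    intro x
    obtain ⟨φ, rfl, hS, hO⟩ := h.trans v x
    refine ⟨φ u, (hO _ _).2 hvu, fun w h1 h2 h3 => ?_⟩
    obtain ⟨w, rfl⟩ := φ.surjective w
    exact hn w (fun e => h1 (e ▸ rfl)) ((hS _ _).1 h2) ((isLinked_map hS hO _ _).1 h3)
  obtain ⟨b, c, hab, hac, hbc, hcl⟩ := h.class_eq v
  have sab : S v b := (hcl b).2 (by simp)
  have sac : S v c := (hcl c).2 (by simp)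
  have sbc : S b c := tr (sy sab) sac
  obtain ⟨p₁, op1, hp1⟩ := hE v
  obtain ⟨q₁, oq1, hq1⟩ := hE b
  obtain ⟨r₁, or1, hr1⟩ := hE c
  obtain ⟨p₂, np, op2⟩ := h.other op1
  obtain ⟨q₂, nq, oq2⟩ := h.other oq1
  obtain ⟨r₂, nr, or2⟩ := h.other or1
  have out : ∀ {x y z}, S v x → O x y → S v z → z ≠ y := fun hx hy hz hyz =>
    h.not_rel hy (tr (sy hx) (hyz ▸ hz))
  -- the independent transversals among the outer neighbours that are not in a common triangle
  have str : ∀ {p q r}, O v p → O b q → O c r → ¬ S p q → ¬ S q r → ¬ S p r →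
      O p q ∨ O q r ∨ O p r := by
    intro p q r hp hq hr n1 n2 n3
    rcases h.strong hab hac hbc sab sac hp hq hr with (h1 | h1) | (h1 | h1) | (h1 | h1)
    exacts [absurd h1 n1, Or.inl h1, absurd h1 n2, Or.inr (Or.inl h1), absurd h1 n3,
      Or.inr (Or.inr h1)]
  have n11 : ¬ S p₁ q₁ := fun s => hp1 b hab sab ⟨q₁, s, oq1⟩
  have n12 : ¬ S p₁ q₂ := fun s => hp1 b hab sab ⟨q₂, s, oq2⟩
  have n13 : ¬ S p₁ r₁ := fun s => hp1 c hac sac ⟨r₁, s, or1⟩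
  have n14 : ¬ S p₁ r₂ := fun s => hp1 c hac sac ⟨r₂, s, or2⟩
  have n21 : ¬ S p₂ q₁ := fun s => hq1 v hab.symm (sy sab) ⟨p₂, sy s, op2⟩
  have n23 : ¬ S p₂ r₁ := fun s => hr1 v hac.symm (sy sac) ⟨p₂, sy s, op2⟩
  have m11 : ¬ S q₁ r₁ := fun s => hq1 c hbc sbc ⟨r₁, s, or1⟩
  have m12 : ¬ S q₁ r₂ := fun s => hq1 c hbc sbc ⟨r₂, s, or2⟩
  have m21 : ¬ S q₂ r₁ := fun s => hr1 b hbc.symm (sy sbc) ⟨q₂, sy s, oq2⟩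
  have npq : ∀ {p q}, O v p → O b q → p ≠ q := fun hp hq e => hab (h.inj_right hp (e ▸ hq) sab)
  have npr : ∀ {p q}, O v p → O c q → p ≠ q := fun hp hq e => hac (h.inj_right hp (e ▸ hq) sac)
  have nqr : ∀ {p q}, O b p → O c q → p ≠ q := fun hp hq e => hbc (h.inj_right hp (e ▸ hq) sbc)
  -- an outer neighbour of the triangle has at most one outer neighbour outside it
  have deg : ∀ {w p x y w₁ w₂}, O w p → O p x → O p y → S v w → S v w₁ → S v w₂ → O w₁ x →
      O w₂ y → x = y := by
    intro w p x y w₁ w₂ ow ox oy sw s1 s2 o1 o2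
    rcases h.two (h.symm ow) ox (out s1 o1 sw) oy with e | e
    exacts [absurd e.symm (out s2 o2 sw), e.symm]
  have dp : ∀ {p x y w₁ w₂}, O v p → O p x → O p y → S v w₁ → S v w₂ → O w₁ x → O w₂ y →
    x = y := fun h1 h2 h3 => deg h1 h2 h3 rf
  have dq : ∀ {p x y w₁ w₂}, O b p → O p x → O p y → S v w₁ → S v w₂ → O w₁ x → O w₂ y →
    x = y := fun h1 h2 h3 => deg h1 h2 h3 sab
  have dr : ∀ {p x y w₁ w₂}, O c p → O p x → O p y → S v w₁ → S v w₂ → O w₁ x → O w₂ y →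
    x = y := fun h1 h2 h3 => deg h1 h2 h3 sac
  rcases str op1 oq1 or1 n11 m11 n13 with h1 | h1 | h1
  · rcases str op1 oq2 or1 n12 m21 n13 with h2 | h2 | h2
    · exact nq (dp op1 h1 h2 sab sab oq1 oq2)
    · rcases str op2 oq1 or1 n21 m11 n23 with h3 | h3 | h3
      · exact np (dq oq1 (h.symm h1) (h.symm h3) rf rf op1 op2)
      · exact npr op1 or1 (dq oq1 (h.symm h1) h3 rf sac op1 or1)
      · exact npq op2 oq2 (dr or1 (h.symm h3) (h.symm h2) rf sab op2 oq2)
    · exact nqr oq1 or1 (dp op1 h1 h2 sab sac oq1 or1)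
  · rcases str op1 oq1 or2 n11 m12 n14 with h2 | h2 | h2
    · exact npr op1 or1 (dq oq1 (h.symm h2) h1 rf sac op1 or1)
    · exact nr (dq oq1 h1 h2 sac sac or1 or2)
    · rcases str op1 oq2 or1 n12 m21 n13 with h3 | h3 | h3
      · exact nqr oq2 or2 (dp op1 h3 h2 sab sac oq2 or2)
      · exact nq (dr or1 (h.symm h1) (h.symm h3) sab sab oq1 oq2)
      · exact nr (dp op1 h3 h2 sac sac or1 or2)
  · rcases str op1 oq1 or2 n11 m12 n14 with h2 | h2 | h2
    · exact nqr oq1 or1 (dp op1 h2 h1 sab sac oq1 or1)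
    · rcases str op2 oq1 or1 n21 m11 n23 with h3 | h3 | h3
      · exact npr op2 or2 (dq oq1 (h.symm h3) h2 rf sac op2 or2)
      · exact nr (dq oq1 h3 h2 sac sac or1 or2)
      · exact np (dr or1 (h.symm h1) (h.symm h3) rf rf op1 op2)
    · exact nr (dp op1 h1 h2 sac sac or1 or2)

/-- Any two linked triangles are joined by a perfect matching. -/
theorem isLinked_of_rel (h : IsTriangleSystem S O) {v u w : V} (hvu : O v u) (sw : S v w) :
    IsLinked S O w u := by
  by_cases hvw : v = w
  · exact hvw ▸ ⟨u, S.refl u, hvu⟩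
  by_contra hw
  refine h.not_single_link hvu fun x hvx sx hx => hw ?_
  by_cases hxw : x = w
  · exact hxw ▸ hx
  · exact h.not_double_link hvu hvx hvw hxw sx sw hx

end IsTriangleSystem

/-! ### Every vertex in a unique triangle: the cycle of triangles -/

/-- A sequence with `w n = w 0` descends to a cyclic sequence indexed by `ZMod n`. -/
theorem apply_val_add_one {α : Type*} {n : ℕ} (hn : 2 ≤ n) {w : ℕ → α} (hw : w n = w 0)
    (k : ZMod n) : w (k + 1).val = w (k.val + 1) := by
  have : Fact (1 < n) := ⟨hn⟩
  have : NeZero n := ⟨by omega⟩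
  have hk := ZMod.val_lt k
  rw [ZMod.val_add, ZMod.val_one]
  rcases Nat.lt_or_ge (k.val + 1) n with h1 | h1
  · rw [Nat.mod_eq_of_lt h1]
  · rw [show k.val + 1 = n by omega, Nat.mod_self, hw]

/-- The Cayley graph has minimum degree at least four. -/
theorem exists_neighbors_addCayley {k : ℕ} (hk : 3 ≤ k) (x : ZMod (3 * k)) :
    ∃ p q r s, p ≠ q ∧ p ≠ r ∧ p ≠ s ∧ q ≠ r ∧ q ≠ s ∧ r ≠ s ∧
      (addCayley ({1, -1, (k : ZMod (3 * k)), -(k : ZMod (3 * k))} : Set (ZMod (3 * k)))).Adj x p ∧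
      (addCayley ({1, -1, (k : ZMod (3 * k)), -(k : ZMod (3 * k))} : Set (ZMod (3 * k)))).Adj x q ∧
      (addCayley ({1, -1, (k : ZMod (3 * k)), -(k : ZMod (3 * k))} : Set (ZMod (3 * k)))).Adj x r ∧
      (addCayley ({1, -1, (k : ZMod (3 * k)), -(k : ZMod (3 * k))} : Set (ZMod (3 * k)))).Adj x s :=
    by
  have hne : ∀ c : ℕ, 0 < c → c < 3 * k → (c : ZMod (3 * k)) ≠ 0 := by
    intro c h0 h1 h2
    rw [ZMod.natCast_eq_zero_iff] at h2
    exact absurd (Nat.le_of_dvd h0 h2) (by omega)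
  have h1 : (1 : ZMod (3 * k)) ≠ 0 := by simpa using hne 1 (by omega) (by omega)
  have h2 : (1 : ZMod (3 * k)) + 1 ≠ 0 := fun e =>
    hne 2 (by omega) (by omega) (by push_cast; linear_combination e)
  have hk0 : (k : ZMod (3 * k)) ≠ 0 := hne k (by omega) (by omega)
  have hkk : (k : ZMod (3 * k)) + k ≠ 0 := by simpa using hne (k + k) (by omega) (by omega)
  have hk1 : (k : ZMod (3 * k)) + 1 ≠ 0 := by simpa using hne (k + 1) (by omega) (by omega)
  have hk2 : (k : ZMod (3 * k)) ≠ 1 := by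
    intro e
    refine hne (k - 1) (by omega) (by omega) ?_
    rw [Nat.cast_sub (by omega), e]
    simp
  refine ⟨x + 1, x - 1, x + k, x - k, ?_⟩
  simp only [addCayley_pm_adj]
  refine ⟨fun e => h2 (by linear_combination e), fun e => hk2 (by linear_combination -e),
    fun e => hk1 (by linear_combination e), fun e => hk1 (by linear_combination -e),
    fun e => hk2 (by linear_combination e), fun e => hkk (by linear_combination e),
    ⟨fun e => h1 (by linear_combination -e), Or.inl trivial⟩,
    ⟨fun e => h1 (by linear_combination e), Or.inr (Or.inl (by ring))⟩,
    ⟨fun e => hk0 (by linear_combination -e), Or.inr (Or.inr (Or.inl trivial))⟩,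
    ⟨fun e => hk0 (by linear_combination e), Or.inr (Or.inr (Or.inr (by ring)))⟩⟩

namespace IsTriangleSystem

variable {S : Setoid V} {O : V → V → Prop}

/-- A walk along outer edges that never turns back. -/
def IsOuterWalk (O : V → V → Prop) (w : ℕ → V) : Prop :=
  ∀ i, O (w i) (w (i + 1)) ∧ w i ≠ w (i + 2)

theorem exists_isOuterWalk (h : IsTriangleSystem S O) {x y : V} (hxy : O x y) :
    ∃ w, IsOuterWalk O w ∧ w 0 = x ∧ w 1 = y := by
  have hst : ∀ p : {p : V × V // O p.1 p.2}, ∃ q : {p : V × V // O p.1 p.2},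
      q.1.1 = p.1.2 ∧ p.1.1 ≠ q.1.2 := by
    rintro ⟨⟨u, v⟩, huv⟩
    obtain ⟨t, h1, h2⟩ := h.other (h.symm huv)
    exact ⟨⟨(v, t), h2⟩, rfl, h1⟩
  choose st hst1 hst2 using hst
  let p : ℕ → {p : V × V // O p.1 p.2} := fun i => st^[i] ⟨(x, y), hxy⟩
  have hp : ∀ i, p (i + 1) = st (p i) := fun i => Function.iterate_succ_apply' _ _ _
  have hp2 : ∀ i, (p (i + 1)).1.1 = (p i).1.2 := fun i => by rw [hp, hst1]
  refine ⟨fun i => (p i).1.1, fun i => ⟨?_, ?_⟩, rfl, hp2 0⟩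
  · dsimp only
    rw [hp2]
    exact (p i).2
  · dsimp only
    rw [show i + 2 = i + 1 + 1 from rfl, hp2, hp]
    exact hst2 _

theorem IsOuterWalk.shift {w : ℕ → V} (hw : IsOuterWalk O w) (i : ℕ) :
    IsOuterWalk O fun k => w (i + k) := fun k => hw (i + k)

/-- An outer walk is determined by its first two vertices. -/
theorem IsOuterWalk.eq_of_eq_start (h : IsTriangleSystem S O) {w w' : ℕ → V} (hw : IsOuterWalk O w)
    (hw' : IsOuterWalk O w') (h0 : w 0 = w' 0) (h1 : w 1 = w' 1) (i : ℕ) : w i = w' i := by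
  suffices w i = w' i ∧ w (i + 1) = w' (i + 1) from this.1
  induction i with
  | zero => exact ⟨h0, h1⟩
  | succ i ih =>
    refine ⟨ih.2, ?_⟩
    have h2 := (hw' (i + 1)).1
    rw [← ih.2] at h2
    rcases h.two (h.symm (hw i).1) (hw (i + 1)).1 (hw i).2 h2 with e | e
    · exact absurd (ih.1.symm.trans e.symm) (hw' i).2
    · exact e.symm

theorem IsOuterWalk.not_rel_two (h : IsTriangleSystem S O) {w : ℕ → V} (hw : IsOuterWalk O w)
    (i : ℕ) : ¬ S (w i) (w (i + 2)) := fun s =>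
  (hw i).2 (h.inj (h.symm (hw i).1) (hw (i + 1)).1 s)

/-- Two outer walks that start parallel stay parallel. -/
theorem IsOuterWalk.rel (h : IsTriangleSystem S O) {w w' : ℕ → V} (hw : IsOuterWalk O w)
    (hw' : IsOuterWalk O w') (h0 : S (w 0) (w' 0)) (h1 : S (w 1) (w' 1)) (i : ℕ) :
    S (w i) (w' i) := by
  suffices S (w i) (w' i) ∧ S (w (i + 1)) (w' (i + 1)) from this.1
  induction i with
  | zero => exact ⟨h0, h1⟩
  | succ i ih =>
    refine ⟨ih.2, ?_⟩
    obtain ⟨x, hx1, hx2⟩ := h.isLinked_of_rel (hw (i + 1)).1 ih.2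
    rcases h.two (h.symm (hw' i).1) (hw' (i + 1)).1 (hw' i).2 hx2 with rfl | rfl
    · exact absurd (S.trans ih.1 (S.symm hx1)) (hw.not_rel_two h i)
    · exact hx1

theorem IsOuterWalk.ne (h : IsTriangleSystem S O) {w w' : ℕ → V} (hw : IsOuterWalk O w)
    (hw' : IsOuterWalk O w') (hs : ∀ i, S (w i) (w' i)) (h0 : w 0 ≠ w' 0) (i : ℕ) :
    w i ≠ w' i := by
  induction i with
  | zero => exact h0
  | succ i ih => exact fun e => ih (h.inj_right (hw i).1 (e ▸ (hw' i).1) (hs i))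

/-- Three parallel outer walks through a cyclic sequence of `n` triangles. -/
structure IsStrip (S : Setoid V) (O : V → V → Prop) (n : ℕ) (x y z : ℕ → V) : Prop where
  three_le : 3 ≤ n
  walk_x : IsOuterWalk O x
  walk_y : IsOuterWalk O y
  walk_z : IsOuterWalk O z
  rel_xy : ∀ i, S (x i) (y i)
  rel_xz : ∀ i, S (x i) (z i)
  ne_xy : ∀ i, x i ≠ y i
  ne_xz : ∀ i, x i ≠ z i
  ne_yz : ∀ i, y i ≠ z i
  closed : S (x n) (x 0)
  inj : ∀ k l, k < n → l < n → S (x k) (x l) → k = l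

namespace IsStrip

variable {n : ℕ} {x y z : ℕ → V}

theorem rotate (s : IsStrip S O n x y z) : IsStrip S O n y z x where
  three_le := s.three_le
  walk_x := s.walk_y
  walk_y := s.walk_z
  walk_z := s.walk_x
  rel_xy i := S.trans (S.symm (s.rel_xy i)) (s.rel_xz i)
  rel_xz i := S.symm (s.rel_xy i)
  ne_xy := s.ne_yz
  ne_xz i := (s.ne_xy i).symm
  ne_yz i := (s.ne_xz i).symm
  closed := S.trans (S.symm (s.rel_xy n)) (S.trans s.closed (s.rel_xy 0))
  inj k l hk hl h := s.inj k l hk hl (S.trans (s.rel_xy k) (S.trans h (S.symm (s.rel_xy l))))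

theorem swap (s : IsStrip S O n x y z) : IsStrip S O n x z y where
  three_le := s.three_le
  walk_x := s.walk_x
  walk_y := s.walk_z
  walk_z := s.walk_y
  rel_xy := s.rel_xz
  rel_xz := s.rel_xy
  ne_xy := s.ne_xz
  ne_xz := s.ne_xy
  ne_yz i := (s.ne_yz i).symm
  closed := s.closed
  inj := s.inj

/-- If one of the parallel walks arrives after `n` steps where another one starts, it continues
along the latter. -/
theorem eq_of_closed (h : IsTriangleSystem S O) (s : IsStrip S O n x y z) {u v : ℕ → V}
    (hu : IsOuterWalk O u) (hv : IsOuterWalk O v) (ru : ∀ i, S (x i) (u i))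
    (rv : ∀ i, S (x i) (v i)) (huv : u n = v 0) (t : ℕ) : u (n + t) = v t := by
  have hn := s.three_le
  refine IsOuterWalk.eq_of_eq_start h (hu.shift n) hv huv ?_ t
  have h1 := (hv 0).1
  rw [← huv] at h1
  have h2 := hu (n - 1)
  rw [show n - 1 + 1 = n by omega, show n - 1 + 2 = n + 1 by omega] at h2
  rcases h.two (h.symm h2.1) (hu n).1 h2.2 h1 with e | e
  · have := s.inj 1 (n - 1) (by omega) (by omega)
      (S.trans (rv 1) (S.trans (e ▸ S.refl _) (S.symm (ru (n - 1)))))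
    omega
  · exact e.symm

/-- A strip that closes up with the identity. -/
theorem nonempty_iso_boxProd (h4 : G.IsFourValent) (hc : G.Connected)
    (hadj : ∀ u v, G.Adj u v ↔ (S u v ∧ u ≠ v) ∨ O u v) (s : IsStrip S O n x y z)
    (hx : x n = x 0) (hy : y n = y 0) (hz : z n = z 0) :
    Nonempty (G ≃g (cycleGraph 3).boxProd (cycleGraph n)) := by
  have hn := s.three_le
  have : NeZero n := ⟨by omega⟩
  have hS : ∀ (k : ZMod n) i, S (x k.val) (![x k.val, y k.val, z k.val] i) := by
    intro k i
    fin_cases i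
    exacts [S.refl _, s.rel_xy _, s.rel_xz _]
  refine h4.nonempty_iso_boxProd_of_layers hc hn (fun k => ![x k.val, y k.val, z k.val]) ?_ ?_ ?_
  · intro k
    refine adj_vec3 ((hadj _ _).2 (Or.inl ⟨s.rel_xy _, s.ne_xy _⟩))
      ((hadj _ _).2 (Or.inl ⟨s.rel_xz _, s.ne_xz _⟩)) ((hadj _ _).2 (Or.inl ⟨?_, s.ne_yz _⟩))
    exact S.trans (S.symm (s.rel_xy _)) (s.rel_xz _)
  · intro k l i j hkl
    refine ZMod.val_injective n (s.inj _ _ (ZMod.val_lt k) (ZMod.val_lt l) ?_)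
    refine S.trans (hS k i) ?_
    rw [hkl]
    exact S.symm (hS l j)
  · intro k i
    refine (hadj _ _).2 (Or.inr ?_)
    fin_cases i
    · change O (x k.val) (x (k + 1).val)
      rw [apply_val_add_one (by omega) hx]
      exact (s.walk_x _).1
    · change O (y k.val) (y (k + 1).val)
      rw [apply_val_add_one (by omega) hy]
      exact (s.walk_y _).1
    · change O (z k.val) (z (k + 1).val)
      rw [apply_val_add_one (by omega) hz]
      exact (s.walk_z _).1

/-- A strip that closes up with a 3-cycle: the three walks form a single outer cycle through all
`3 * n` vertices. -/
theorem nonempty_iso_addCayley (h : IsTriangleSystem S O) (h4 : G.IsFourValent)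
    (hc : G.Connected) (hadj : ∀ u v, G.Adj u v ↔ (S u v ∧ u ≠ v) ∨ O u v)
    (s : IsStrip S O n x y z) (hx : x n = y 0) (hy : y n = z 0) (hz : z n = x 0) :
    Nonempty (G ≃g addCayley ({1, -1, (n : ZMod (3 * n)), -(n : ZMod (3 * n))} :
      Set (ZMod (3 * n)))) := by
  have hn := s.three_le
  have : NeZero (3 * n) := ⟨by omega⟩
  have rx : ∀ i, S (x i) (x i) := fun i => S.refl _
  have hx' := s.eq_of_closed h s.walk_x s.walk_y rx s.rel_xy hx
  have hy' := s.eq_of_closed h s.walk_y s.walk_z s.rel_xy s.rel_xz hy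
  have hz' := s.eq_of_closed h s.walk_z s.walk_x s.rel_xz rx hz
  have hper : Function.Periodic x (3 * n) := by
    intro t
    rw [show t + 3 * n = n + (n + (n + t)) by ring, hx', hy', hz']
  have h1 : ∀ u : ZMod (3 * n), O (x u.val) (x (u + 1).val) := by
    intro u
    rw [apply_val_add_one (w := x) (by omega) (by simpa using hper 0)]
    exact (s.walk_x _).1
  have h2 : ∀ u : ZMod (3 * n), S (x u.val) (x (u + n).val) ∧ x u.val ≠ x (u + n).val := by
    intro u
    have e : x (u + n).val = y u.val := by
      rw [ZMod.val_add, ZMod.val_natCast, Nat.mod_eq_of_lt (show n < 3 * n by omega),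
        hper.map_mod_nat, add_comm, hx']
    rw [e]
    exact ⟨s.rel_xy _, s.ne_xy _⟩
  refine h4.nonempty_iso hc (fun u : ZMod (3 * n) => x u.val) ?_ ?_
    (exists_neighbors_addCayley hn)
  · -- the position `q * n + r` is in the `r`-th triangle, on the `q`-th of the three walks
    have hpos : ∀ u : ZMod (3 * n), ∃ (q : Fin 3) (r : ℕ), u.val = n * q + r ∧ r < n ∧
        x u.val = ![x r, y r, z r] q := by
      intro u
      have hu := ZMod.val_lt u
      have h3 : u.val / n < 3 := by
        rw [Nat.div_lt_iff_lt_mul (by omega)]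
        exact hu
      obtain ⟨q, hq⟩ : ∃ q : Fin 3, (q : ℕ) = u.val / n := ⟨⟨_, h3⟩, rfl⟩
      have h5 := Nat.div_add_mod u.val n
      rw [← hq] at h5
      refine ⟨q, u.val % n, h5.symm, Nat.mod_lt _ (by omega), ?_⟩
      generalize u.val % n = r at *
      rw [← h5]
      fin_cases q
      · simp
      · change x (n * 1 + r) = y r
        rw [mul_one, hx']
      · change x (n * 2 + r) = z r
        rw [show n * 2 + r = n + (n + r) by ring, hx', hy']
    intro u v huv
    obtain ⟨q, r, e1, hr, f1⟩ := hpos u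
    obtain ⟨q', r', e2, hr', f2⟩ := hpos v
    have hS : ∀ r q, S (x r) (![x r, y r, z r] q) := by
      intro r q
      fin_cases q
      exacts [S.refl _, s.rel_xy _, s.rel_xz _]
    have huv : x u.val = x v.val := huv
    rw [f1, f2] at huv
    have hrr : r = r' := s.inj r r' hr hr' (S.trans (hS r q) (huv ▸ S.symm (hS r' q')))
    subst hrr
    have hqq : q = q' := by
      have n1 := s.ne_xy r
      have n2 := s.ne_xz r
      have n3 := s.ne_yz r
      have n4 := n1.symm
      have n5 := n2.symm
      have n6 := n3.symm
      fin_cases q <;> fin_cases q' <;> first | rfl | exact absurd huv (by assumption)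
    exact ZMod.val_injective _ (by rw [e1, e2, hqq])
  · intro u v huv
    rw [addCayley_pm_adj] at huv
    rw [hadj]
    rcases huv with ⟨-, rfl | rfl | rfl | rfl⟩
    · exact Or.inr (h1 u)
    · exact Or.inr (h.symm (h1 v))
    · exact Or.inl (h2 u)
    · exact Or.inl ⟨S.symm (h2 v).1, (h2 v).2.symm⟩

/-- If the strip closed up with a transposition, the two interchanged walks would form one outer
cycle meeting a triangle twice, but the outer cycle of the third walk meets it only once. -/
theorem not_transposition (h : IsTriangleSystem S O) (s : IsStrip S O n x y z) (hx : x n = y 0)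
    (hz : z n = z 0) : False := by
  have hn := s.three_le
  obtain ⟨φ, hφ, hS, hO⟩ := h.trans (x 0) (z 0)
  have hreach : ∀ i, Relation.ReflTransGen O (x 0) (x i) := by
    intro i
    induction i with
    | zero => exact .refl
    | succ i ih => exact ih.tail (s.walk_x i).1
  have h1 : Relation.ReflTransGen O (z 0) (φ (y 0)) := by
    rw [← hφ, ← hx]
    exact (hreach n).lift φ fun _ _ hab => (hO _ _).2 hab
  have h2 : S (z 0) (φ (y 0)) := by
    rw [← hφ]
    exact (hS _ _).2 (s.rel_xy 0)
  have h3 : z 0 ≠ φ (y 0) := by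
    rw [← hφ]
    exact φ.injective.ne (s.ne_xy 0)
  have hz' := s.eq_of_closed h s.walk_z s.walk_z s.rel_xz s.rel_xz hz
  have hcl : ∀ u, Relation.ReflTransGen O (z 0) u → ∃ i, u = z i := by
    intro u hu
    induction hu with
    | refl => exact ⟨0, rfl⟩
    | tail _ huv ih =>
      obtain ⟨i, rfl⟩ := ih
      rw [← hz' i, show n + i = n - 1 + i + 1 by omega] at huv
      rcases h.two (h.symm (s.walk_z (n - 1 + i)).1) (s.walk_z (n - 1 + i + 1)).1
        (s.walk_z (n - 1 + i)).2 huv with rfl | rfl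
      exacts [⟨_, rfl⟩, ⟨_, rfl⟩]
  obtain ⟨i, hi⟩ := hcl _ h1
  rw [hi] at h2 h3
  have hper : Function.Periodic z n := fun t => by rw [add_comm, hz']
  rw [← hper.map_mod_nat i] at h2 h3
  have := s.inj 0 (i % n) (by omega) (Nat.mod_lt _ (by omega))
    (S.trans (s.rel_xz 0) (S.trans h2 (S.symm (s.rel_xz _))))
  rw [← this] at h3
  exact h3 rfl

end IsStrip

/-- Follow outer edges until a triangle is met again.  The matchings between linked triangles yield
the two parallel walks. -/
theorem exists_isStrip [Finite V] [Nonempty V] (h : IsTriangleSystem S O) :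
    ∃ n x y z, IsStrip S O n x y z := by
  obtain ⟨q, _, -, hq⟩ := h.outer (Classical.arbitrary V)
  obtain ⟨w, hw, -, -⟩ := h.exists_isOuterWalk ((hq q).2 (Or.inl rfl))
  obtain ⟨i, n, hn, hin, hinj⟩ := exists_closed_stretch (fun i => Quotient.mk S (w i))
    (fun i hi => h.not_rel (hw i).1 (Quotient.exact hi))
    (fun i hi => hw.not_rel_two h i (Quotient.exact hi))
  have hx := hw.shift i
  obtain ⟨b, c, hab, hac, hbc, hcl⟩ := h.class_eq (w (i + 0))
  have sb : S (w (i + 0)) b := (hcl b).2 (by simp)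
  have sc : S (w (i + 0)) c := (hcl c).2 (by simp)
  obtain ⟨b₁, hb1, hb2⟩ := h.isLinked_of_rel (hx 0).1 sb
  obtain ⟨c₁, hc1, hc2⟩ := h.isLinked_of_rel (hx 0).1 sc
  obtain ⟨y, hy, rfl, rfl⟩ := h.exists_isOuterWalk hb2
  obtain ⟨z, hz, rfl, rfl⟩ := h.exists_isOuterWalk hc2
  have rxy := hx.rel h hy sb hb1
  have rxz := hx.rel h hz sc hc1
  have ryz : ∀ k, S (y k) (z k) := fun k => S.trans (S.symm (rxy k)) (rxz k)
  exact ⟨n, _, y, z, hn, hx, hy, hz, rxy, rxz, hx.ne h hy rxy hab, hx.ne h hz rxz hac,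
    hy.ne h hz ryz hbc, Quotient.exact hin, fun k l hk hl hs => hinj k l hk hl (Quotient.sound hs)⟩

/-- Distinguish by the permutation with which the strip closes up. -/
theorem nonempty_iso [Finite V] (h : IsTriangleSystem S O) (h4 : G.IsFourValent)
    (hc : G.Connected) (hadj : ∀ u v, G.Adj u v ↔ (S u v ∧ u ≠ v) ∨ O u v) :
    (∃ k : ℕ, 2 ≤ k ∧ Nonempty (G ≃g addCayley
      ({1, -1, (k : ZMod (3 * k)), -(k : ZMod (3 * k))} : Set (ZMod (3 * k))))) ∨
    (∃ n : ℕ, 3 ≤ n ∧ Nonempty (G ≃g (cycleGraph 3).boxProd (cycleGraph n))) := by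
  have := hc.nonempty
  obtain ⟨n, x, y, z, s⟩ := h.exists_isStrip
  have hn := s.three_le
  have hmem : ∀ {v}, S (x 0) v → v = x 0 ∨ v = y 0 ∨ v = z 0 :=
    h.mates (s.ne_xy 0) (s.ne_xz 0) (s.ne_yz 0) (s.rel_xy 0) (s.rel_xz 0)
  have nxy := s.ne_xy n
  have nxz := s.ne_xz n
  have nyz := s.ne_yz n
  rcases hmem (S.symm s.closed) with ex | ex | ex <;>
    rcases hmem (S.trans (S.symm s.closed) (s.rel_xy n)) with ey | ey | ey <;>
    rcases hmem (S.trans (S.symm s.closed) (s.rel_xz n)) with ez | ez | ez <;>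
    first
    | exact absurd (ex.trans ey.symm) nxy
    | exact absurd (ex.trans ez.symm) nxz
    | exact absurd (ey.trans ez.symm) nyz
    | exact Or.inr ⟨n, hn, s.nonempty_iso_boxProd h4 hc hadj ex ey ez⟩
    | exact Or.inl ⟨n, by omega, s.nonempty_iso_addCayley h h4 hc hadj ex ey ez⟩
    | exact Or.inl ⟨n, by omega, s.swap.nonempty_iso_addCayley h h4 hc hadj ex ez ey⟩
    | exact absurd (s.not_transposition h ex ez) id
    | exact absurd (s.swap.not_transposition h ex ey) id
    | exact absurd (s.rotate.not_transposition h ey ex) id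

end IsTriangleSystem

/-- If there is a strong triangle, every edge is in at most one triangle and some edge is in none,
then the edges in triangles form a partition into strong triangles. -/
theorem IsStrongClique.isTriangleSystem [Finite V] (h : G.IsFourValent)
    (hvt : G.IsVertexTransitive) (hone : ∀ u v x y, G.Adj u v → G.Adj u x → G.Adj v x →
      G.Adj u y → G.Adj v y → x = y) (htri : ¬ ∀ u v, G.Adj u v → ∃ x, G.Adj u x ∧ G.Adj v x)
    {a b c : V} (hab : G.Adj a b) (hac : G.Adj a c) (hbc : G.Adj b c)
    (hs : G.IsStrongClique {a, b, c}) :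
    ∃ (S : Setoid V) (O : V → V → Prop), IsTriangleSystem S O ∧
      ∀ u v, G.Adj u v ↔ (S u v ∧ u ≠ v) ∨ O u v := by
  let T : V → V → Prop := fun u v => G.Adj u v ∧ ∃ x, G.Adj u x ∧ G.Adj v x
  let O : V → V → Prop := fun u v => G.Adj u v ∧ ¬ ∃ x, G.Adj u x ∧ G.Adj v x
  have Tsymm : ∀ {u v}, T u v → T v u := fun ⟨h1, x, h2, h3⟩ => ⟨h1.symm, x, h3, h2⟩
  have Tmap : ∀ (φ : G ≃g G) u v, T (φ u) (φ v) ↔ T u v := by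
    intro φ u v
    constructor
    · rintro ⟨h1, x, h2, h3⟩
      obtain ⟨x, rfl⟩ := φ.surjective x
      exact ⟨φ.map_adj_iff.1 h1, x, φ.map_adj_iff.1 h2, φ.map_adj_iff.1 h3⟩
    · rintro ⟨h1, x, h2, h3⟩
      exact ⟨φ.map_adj_iff.2 h1, φ x, φ.map_adj_iff.2 h2, φ.map_adj_iff.2 h3⟩
  have TO : ∀ u v, O u v ↔ G.Adj u v ∧ ¬ T u v := fun u v =>
    ⟨fun h => ⟨h.1, fun h' => h.2 h'.2⟩, fun h => ⟨h.1, fun h' => h.2 ⟨h.1, h'⟩⟩⟩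
  have Omap : ∀ (φ : G ≃g G) u v, O (φ u) (φ v) ↔ O u v := by
    intro φ u v
    rw [TO, TO, Tmap, φ.map_adj_iff]
  have nbrs : ∀ v, ∃ x y p q, v ≠ x ∧ v ≠ y ∧ x ≠ y ∧ p ≠ q ∧ G.Adj x y ∧
      G.IsStrongClique {v, x, y} ∧ (∀ u, T v u ↔ u = x ∨ u = y) ∧
      ∀ u, O v u ↔ u = p ∨ u = q := by
    intro v
    obtain ⟨x, y, hvx, hvy, hxy, hst⟩ := hvt.exists_strong_triangle hab hac hbc hs v
    obtain ⟨p, q, n1, n2, n3, n4, n5, hN⟩ := h.two hvx hvy hxy.ne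
    have hp : G.Adj v p := by simp [hN]
    have hq : G.Adj v q := by simp [hN]
    have Tx : T v x := ⟨hvx, y, hvy, hxy⟩
    have Ty : T v y := ⟨hvy, x, hvx, hxy.symm⟩
    have hpq : ¬ G.Adj p q := by
      intro hpq
      refine htri fun u w huw => ?_
      obtain ⟨φ, rfl⟩ := hvt v u
      obtain ⟨w, rfl⟩ := φ.surjective w
      refine ((Tmap φ v w).2 ?_).2
      have hw := (hN w).1 (φ.map_adj_iff.1 huw)
      rcases hw with rfl | rfl | rfl | rfl
      exacts [Tx, Ty, ⟨hp, q, hq, hpq⟩, ⟨hq, p, hp, hpq.symm⟩]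
    have far : ∀ {p}, G.Adj v p → x ≠ p → y ≠ p → ¬ G.Adj p x ∧ ¬ G.Adj p y := by
      intro p hp h1 h2
      exact ⟨fun hpx => h2 (hone v x y p hvx hvy hxy hp hpx.symm),
        fun hpy => h1 (hone v y x p hvy hvx hxy.symm hp hpy.symm)⟩
    have Tp : ¬ T v p := by
      rintro ⟨-, w, h1, h2⟩
      have := far hp n1 n2
      rcases (hN w).1 h1 with rfl | rfl | rfl | rfl
      exacts [this.1 h2, this.2 h2, G.irrefl h2, hpq h2]
    have Tq : ¬ T v q := by
      rintro ⟨-, w, h1, h2⟩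
      have := far hq n3 n4
      rcases (hN w).1 h1 with rfl | rfl | rfl | rfl
      exacts [this.1 h2, this.2 h2, hpq h2.symm, G.irrefl h2]
    refine ⟨x, y, p, q, hvx.ne, hvy.ne, hxy.ne, n5, hxy, hst, fun u => ⟨fun hu => ?_, ?_⟩,
      fun u => ⟨fun hu => ?_, ?_⟩⟩
    · rcases (hN u).1 hu.1 with rfl | rfl | rfl | rfl
      exacts [Or.inl rfl, Or.inr rfl, absurd hu Tp, absurd hu Tq]
    · rintro (rfl | rfl)
      exacts [Tx, Ty]
    · rw [TO] at hu
      rcases (hN u).1 hu.1 with rfl | rfl | rfl | rfl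
      exacts [absurd Tx hu.2, absurd Ty hu.2, Or.inl rfl, Or.inr rfl]
    · rw [TO]
      rintro (rfl | rfl)
      exacts [⟨hp, Tp⟩, ⟨hq, Tq⟩]
  let S : Setoid V := ⟨fun u v => u = v ∨ T u v, fun u => Or.inl rfl,
    fun h => h.imp Eq.symm Tsymm, by
      rintro u v w (rfl | h1) (rfl | h2)
      · exact Or.inl rfl
      · exact Or.inr h2
      · exact Or.inr h1
      · by_cases huw : u = w
        · exact Or.inl huw
        obtain ⟨x, y, -, -, -, -, -, -, hxy, -, hT, -⟩ := nbrs v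
        have k1 := (hT u).1 (Tsymm h1)
        have k2 := (hT w).1 h2
        have := hxy.symm
        exact Or.inr ⟨by grind, v, h1.1, h2.1.symm⟩⟩
  have hadj : ∀ u v, G.Adj u v ↔ (S u v ∧ u ≠ v) ∨ O u v := by
    intro u v
    rw [TO]
    constructor
    · intro huv
      by_cases hT : T u v
      · exact Or.inl ⟨Or.inr hT, huv.ne⟩
      · exact Or.inr ⟨huv, hT⟩
    · rintro (⟨h1 | h1, h2⟩ | h1)
      exacts [absurd h1 h2, h1.1, h1.1]
  refine ⟨S, O, ?_, hadj⟩
  constructor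
  · rintro u v ⟨h1, h2⟩
    exact ⟨h1.symm, fun ⟨x, h3, h4⟩ => h2 ⟨x, h4, h3⟩⟩
  · intro v
    obtain ⟨x, y, -, -, n1, n2, n3, -, -, -, hT, -⟩ := nbrs v
    refine ⟨x, y, n1, n2, n3, fun u => ?_⟩
    change v = u ∨ T v u ↔ _
    rw [hT, eq_comm]
  · rintro u v ⟨h1, h2⟩ (rfl | h3)
    · exact G.irrefl h1
    · exact h2 h3.2
  · intro v
    obtain ⟨x, y, p, q, -, -, -, n4, -, -, -, hO⟩ := nbrs v
    exact ⟨p, q, n4, hO⟩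
  · rintro u v w h1 h2 (h3 | h3)
    · exact h3
    · exact absurd ⟨w, h2.1, h3.1⟩ h1.2
  · intro a b c p q r hab hac hbc sb sc hp hq hr
    obtain ⟨x, y, -, -, n1, n2, n3, -, -, hst, hT, -⟩ := nbrs a
    have hb := (hT b).1 (sb.resolve_left hab)
    have hc := (hT c).1 (sc.resolve_left hac)
    have hs : G.IsStrongClique {a, b, c} := by
      rcases hb with rfl | rfl <;> rcases hc with rfl | rfl
      · exact absurd rfl hbc
      · exact hst
      · rwa [Set.pair_comm]
      · exact absurd rfl hbc
    have key : ∀ {u v}, G.Adj u v → S u v ∨ O u v := fun huv =>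
      ((hadj _ _).1 huv).imp (fun h => h.1) id
    exact (hs.triangle hp.1 hq.1 hr.1).imp key fun h => h.imp key key
  · intro u v
    obtain ⟨φ, hφ⟩ := hvt u v
    refine ⟨φ.toEquiv, hφ, fun x y => ?_, Omap φ⟩
    change φ x = φ y ∨ T (φ x) (φ y) ↔ x = y ∨ T x y
    rw [Tmap, φ.injective.eq_iff]

/-! ### Classification and localizability -/

theorem IsStrongClique.nonempty_iso_of_triangle [Finite V] (h : G.IsFourValent)
    (hvt : G.IsVertexTransitive) (hc : G.Connected) {a b c : V} (hab : G.Adj a b) (hac : G.Adj a c)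
    (hbc : G.Adj b c) (hs : G.IsStrongClique {a, b, c}) :
    Nonempty (G ≃g (completeGraph (Fin 3)).lexProduct (⊥ : SimpleGraph (Fin 2))) ∨
    (∃ k : ℕ, 2 ≤ k ∧ Nonempty (G ≃g addCayley
      ({1, -1, (k : ZMod (3 * k)), -(k : ZMod (3 * k))} : Set (ZMod (3 * k))))) ∨
    (∃ n : ℕ, 3 ≤ n ∧ Nonempty (G ≃g (cycleGraph 3).boxProd (cycleGraph n))) := by
  by_cases hoct : Nonempty (G ≃g (completeGraph (Fin 3)).lexProduct (⊥ : SimpleGraph (Fin 2)))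
  · exact Or.inl hoct
  right
  have hone : ∀ u v x y, G.Adj u v → G.Adj u x → G.Adj v x → G.Adj u y → G.Adj v y → x = y :=
    fun u v x y => hs.eq_of_common h hvt hc hoct hab hac hbc
  by_cases htri : ∀ u v, G.Adj u v → ∃ x, G.Adj u x ∧ G.Adj v x
  · exact Or.inr ⟨3, le_rfl, hs.nonempty_iso_rook h hc hone htri hab hac hbc⟩
  · obtain ⟨S, O, hSO, hadj⟩ := hs.isTriangleSystem h hvt hone htri hab hac hbc
    exact hSO.nonempty_iso h hc hadj

theorem IsStrongClique.classification [Finite V] (h : G.IsFourValent)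
    (hvt : G.IsVertexTransitive) (hc : G.Connected) {C : Set V} (hs : G.IsStrongClique C) :
    Nonempty (G ≃g completeBipartiteGraph (Fin 4) (Fin 4)) ∨
    Nonempty (G ≃g completeGraph (Fin 5)) ∨
    Nonempty (G ≃g (completeGraph (Fin 3)).lexProduct (⊥ : SimpleGraph (Fin 2))) ∨
    (∃ n : ℕ, 2 ≤ n ∧ Nonempty (G ≃g graphH n)) ∨
    (∃ k : ℕ, 2 ≤ k ∧ Nonempty (G ≃g addCayley
      ({1, -1, (k : ZMod (3 * k)), -(k : ZMod (3 * k))} : Set (ZMod (3 * k))))) ∨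
    (∃ n : ℕ, 3 ≤ n ∧ Nonempty (G ≃g (cycleGraph 3).boxProd (cycleGraph n))) := by
  obtain ⟨a, ha⟩ := hs.nonempty
  have hcl : ∀ {x y}, x ∈ C → y ∈ C → x ≠ y → G.Adj x y := fun hx hy hxy => hs.1 hx hy hxy
  by_cases hb : ∃ b ∈ C, a ≠ b
  swap
  · -- a single vertex is dominated by any of its neighbours
    exfalso
    obtain ⟨p, q, r, s, -, -, -, -, -, -, hN⟩ := h a
    obtain ⟨x, hx, hD⟩ := (isStrongClique_iff.1 hs).2 {p} (by simp [IsIndepSet])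
    obtain rfl : a = x := by_contra fun e => hb ⟨x, hx, e⟩
    exact hD p rfl ((hN p).2 (Or.inl rfl))
  obtain ⟨b, hb, hab⟩ := hb
  by_cases h3 : ∃ c ∈ C, a ≠ c ∧ b ≠ c
  swap
  · have e : C = {a, b} := by
      ext x
      simp only [Set.mem_insert_iff, Set.mem_singleton_iff]
      refine ⟨fun hx => ?_, by rintro (rfl | rfl) <;> assumption⟩
      by_contra! hn
      exact h3 ⟨x, hx, hn.1.symm, hn.2.symm⟩
    exact Or.inl (h.nonempty_iso_completeBipartiteGraph hc (e ▸ hs))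
  obtain ⟨c, hcC, hac, hbc⟩ := h3
  by_cases h4 : ∃ d ∈ C, a ≠ d ∧ b ≠ d ∧ c ≠ d
  swap
  · have e : C = {a, b, c} := by
      ext x
      simp only [Set.mem_insert_iff, Set.mem_singleton_iff]
      refine ⟨fun hx => ?_, by rintro (rfl | rfl | rfl) <;> assumption⟩
      by_contra! hn
      exact h4 ⟨x, hx, hn.1.symm, hn.2.1.symm, hn.2.2.symm⟩
    rcases IsStrongClique.nonempty_iso_of_triangle h hvt hc (hcl ha hb hab) (hcl ha hcC hac)
      (hcl hb hcC hbc) (e ▸ hs) with k | k | k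
    exacts [Or.inr (Or.inr (Or.inl k)), Or.inr (Or.inr (Or.inr (Or.inr (Or.inl k)))),
      Or.inr (Or.inr (Or.inr (Or.inr (Or.inr k))))]
  obtain ⟨d, hd, had, hbd, hcd⟩ := h4
  by_cases hK : Nonempty (G ≃g completeGraph (Fin 5))
  · exact Or.inr (Or.inl hK)
  by_cases h5 : ∃ e ∈ C, a ≠ e ∧ b ≠ e ∧ c ≠ e ∧ d ≠ e
  · obtain ⟨e, he, hae, hbe, hce, hde⟩ := h5
    exact absurd (h.nonempty_iso_completeGraph hc (hcl ha hb hab) (hcl ha hcC hac) (hcl ha hd had)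
      (hcl ha he hae) (hcl hb hcC hbc) (hcl hb hd hbd) (hcl hb he hbe) (hcl hcC hd hcd)
      (hcl hcC he hce) (hcl hd he hde)) hK
  · have e : C = {a, b, c, d} := by
      ext x
      simp only [Set.mem_insert_iff, Set.mem_singleton_iff]
      refine ⟨fun hx => ?_, by rintro (rfl | rfl | rfl | rfl) <;> assumption⟩
      by_contra! hn
      exact h5 ⟨x, hx, hn.1.symm, hn.2.1.symm, hn.2.2.1.symm, hn.2.2.2.symm⟩
    exact Or.inr (Or.inr (Or.inr (Or.inl
      (h.nonempty_iso_graphH hvt hc hK hab hac had hbc hbd hcd (e ▸ hs)))))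

theorem isLocalizable_of_nonempty_iso [Finite V]
    (h : Nonempty (G ≃g completeBipartiteGraph (Fin 4) (Fin 4)) ∨
      Nonempty (G ≃g completeGraph (Fin 5)) ∨
      Nonempty (G ≃g (completeGraph (Fin 3)).lexProduct (⊥ : SimpleGraph (Fin 2))) ∨
      Nonempty (G ≃g (completeBipartiteGraph (Fin 3) (Fin 3)).lineGraph) ∨
      (∃ n : ℕ, 2 ≤ n ∧ Nonempty (G ≃g graphH n)) ∨
      (∃ k : ℕ, 2 ≤ k ∧ Nonempty (G ≃g addCayley
        ({1, -1, (k : ZMod (3 * k)), -(k : ZMod (3 * k))} : Set (ZMod (3 * k))))) ∨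
      (∃ n : ℕ, 3 ≤ n ∧ Nonempty (G ≃g (cycleGraph 3).boxProd (cycleGraph n)))) :
    G.IsLocalizable := by
  rcases h with ⟨⟨φ⟩⟩ | ⟨⟨φ⟩⟩ | ⟨⟨φ⟩⟩ | ⟨⟨φ⟩⟩ | ⟨n, hn, ⟨φ⟩⟩ | ⟨k, hk, ⟨φ⟩⟩ | ⟨n, hn, ⟨φ⟩⟩
  · exact isLocalizable_completeBipartiteGraph.of_iso φ
  · exact isLocalizable_completeGraph.of_iso φ
  · exact isLocalizable_lexProduct.of_iso φ
  · exact isLocalizable_lineGraph.of_iso φ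
  · have : NeZero n := ⟨by omega⟩
    exact (isLocalizable_graphH hn).of_iso φ
  · have : NeZero (3 * k) := ⟨by omega⟩
    exact (isLocalizable_addCayley hk).of_iso φ
  · exact (isLocalizable_boxProd hn).of_iso φ

end SimpleGraph

theorem theorem5p3 {V : Type*} [Fintype V] (G : SimpleGraph V) [DecidableRel G.Adj]
    (hreg : G.IsRegularOfDegree 4) (hvt : G.IsVertexTransitive) :
    (G.Connected →
      ((∃ C : Set V, G.IsStrongClique C) ↔
        (Nonempty (G ≃g completeBipartiteGraph (Fin 4) (Fin 4)) ∨
          Nonempty (G ≃g SimpleGraph.completeGraph (Fin 5)) ∨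
          Nonempty (G ≃g (SimpleGraph.completeGraph (Fin 3)).lexProduct
            (⊥ : SimpleGraph (Fin 2))) ∨
          Nonempty (G ≃g (completeBipartiteGraph (Fin 3) (Fin 3)).lineGraph) ∨
          (∃ n : ℕ, 2 ≤ n ∧ Nonempty (G ≃g SimpleGraph.graphH n)) ∨
          (∃ k : ℕ, 2 ≤ k ∧ Nonempty (G ≃g SimpleGraph.addCayley
            ({1, -1, (k : ZMod (3 * k)), -(k : ZMod (3 * k))} : Set (ZMod (3 * k))))) ∨
          (∃ n : ℕ, 3 ≤ n ∧ Nonempty (G ≃g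
            (SimpleGraph.cycleGraph 3).boxProd (SimpleGraph.cycleGraph n)))))) ∧
    ((∃ C : Set V, G.IsStrongClique C) → G.IsLocalizable) := by
  have h : G.IsFourValent := fun v => hreg.exists_neighbors v
  refine ⟨fun hc => ⟨fun ⟨C, hC⟩ => ?_, fun hG => ?_⟩, fun ⟨C, hC⟩ => ?_⟩
  · rcases hC.classification h hvt hc with k | k | k | k
    exacts [Or.inl k, Or.inr (Or.inl k), Or.inr (Or.inr (Or.inl k)),
      Or.inr (Or.inr (Or.inr (Or.inr k)))]
  · have := hc.nonempty
    exact (SimpleGraph.isLocalizable_of_nonempty_iso hG).exists_isStrongClique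
  · obtain ⟨v, hv⟩ := hC.nonempty
    refine hvt.isLocalizable_of_component (G.connectedComponentMk v)
      (SimpleGraph.isLocalizable_of_nonempty_iso ?_)
    rcases (hC.toSimpleGraph hv).classification (h.toSimpleGraph _)
      (SimpleGraph.isVertexTransitive_toSimpleGraph hvt _)
      (SimpleGraph.ConnectedComponent.connected_toSimpleGraph _) with k | k | k | k
    exacts [Or.inl k, Or.inr (Or.inl k), Or.inr (Or.inr (Or.inl k)),
      Or.inr (Or.inr (Or.inr (Or.inr k)))]
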